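/- Let $H$ be a complex Hilbert space (inner products are linear in the second variable), let $\mathcal B(H)$ be the algebra of bounded operators on $H$, and write $|x\rangle\langle y|$ for the operator $z\mapsto\langle y,z\rangle x$. Let $(T_t)_{t\ge 0}$ be a quantum Markov semigroup (QMS) on $\mathcal B(H)$, that is, a family of $\sigma$-weakly continuous, completely positive linear maps on $\mathcal B(H)$ with $T_0=\mathrm{id}$, $T_{t+s}=T_tT_s$, $T_t(1)=1$, and $t\mapsto T_t(A)$ $\sigma$-weakly continuous on $[0,\infty)$ for every $A\in\mathcal B(H)$. Let $L$ be its generator: $D(L)$ is the set of $A\in\mathcal B(H)$ for which $\frac1t(T_t(A)-A)$ converges $\sigma$-weakly as $t\to0^+$, and $L(A)$ is the limit. Let $\mathcal A$ be the domain algebra of $L$, i.e. the largest $*$-subalgebra of $\mathcal B(H)$ contained in $D(L)$. For a nonzero positive finite-rank operator $T=\sum_{s=1}^m t_s'\,|k_s'\rangle\langle k_s'|$ with $m\ge 1$, $t_s'>0$ and $(k_s')_{s=1}^m$ orthonormal, put $t=\sum_{s=1}^m t_s'$ and $k_s=\sqrt t\,k_s'$; a vector $h$ of the form $h=\sum_{s=1}^m\|k_s\|^{-2}k_s$,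 for some such decomposition of $T$, is called an associate vector for $T$. Suppose that $T\in D(L)$ is a nonzero positive finite-rank operator and that $h$ is an associate vector for $T$ such that $|Th\rangle\langle Th|\in D(L)$. Let $U=\{x\in H:\ |x\rangle\langle Th|\in\mathcal A\}$, a linear subspace of $H$ that is invariant under $\mathcal A$. Then there exist a Hilbert space $K$, a unital $*$-representation $\pi:\mathcal A\to\mathcal B(K)$ (a unital norm-continuous $*$-homomorphism), and linear maps $G:U\to H$ and $V:U\to K$ such that $$\langle u,L(A)w\rangle=\langle Vu,\pi(A)Vw\rangle_K+\langle u,GAw\rangle+\langle GA^*u,w\rangle$$ for all $u,w\in U$ and all $A\in\mathcal A$. -/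

import Mathlib

open Filter Topology
open scoped NNReal InnerProductSpace CStarAlgebra

universe u

noncomputable section

namespace QMS

variable {H : Type u} [NormedAddCommGroup H] [InnerProductSpace ℂ H]

/-- Square-summable sequences of vectors. -/
abbrev SqSummable (H : Type u) [NormedAddCommGroup H] : Type u :=
  {x : ℕ → H // Summable fun n => ‖x n‖ ^ 2}

/-- The functional `A ↦ ∑ₙ ⟪xₙ, A yₙ⟫` for square-summable sequences `x`, `y`. These are exactly the
functionals `A ↦ tr (A ρ)` with `ρ` of trace class, that is, the predual of the bounded operators. -/
def normalFunctional (p : SqSummable H × SqSummable H) (A : H →L[ℂ] H) : ℂ :=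
  ∑' n, ⟪p.1.1 n, A (p.2.1 n)⟫_ℂ

/-- The `σ`-weak topology on the bounded operators: the coarsest topology for which all the
functionals of the predual are continuous. -/
@[reducible]
def sigmaWeak (H : Type u) [NormedAddCommGroup H] [InnerProductSpace ℂ H] :
    TopologicalSpace (H →L[ℂ] H) :=
  TopologicalSpace.induced (fun A p => normalFunctional p A) Pi.topologicalSpace

/-- `f` converges to `B` in the `σ`-weak topology along `l`. -/
def TendstoSigmaWeak {ι : Type*} (f : ι → H →L[ℂ] H) (l : Filter ι) (B : H →L[ℂ] H) : Prop :=
  Tendsto f l (@nhds _ (sigmaWeak H) B)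

lemma tendstoSigmaWeak_iff {ι : Type*} {f : ι → H →L[ℂ] H} {l : Filter ι} {B : H →L[ℂ] H} :
    TendstoSigmaWeak f l B ↔
      ∀ p, Tendsto (fun i => normalFunctional p (f i)) l (𝓝 (normalFunctional p B)) := by
  unfold TendstoSigmaWeak sigmaWeak
  rw [@nhds_induced _ _ Pi.topologicalSpace, tendsto_comap_iff, tendsto_pi_nhds]
  rfl

lemma summable_inner (p : SqSummable H × SqSummable H) (A : H →L[ℂ] H) :
    Summable fun n => ⟪p.1.1 n, A (p.2.1 n)⟫_ℂ := by
  refine Summable.of_norm_bounded (g := fun n => ‖A‖ * (‖p.1.1 n‖ ^ 2 + ‖p.2.1 n‖ ^ 2))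
    ((p.1.2.add p.2.2).mul_left _) fun n => ?_
  calc ‖⟪p.1.1 n, A (p.2.1 n)⟫_ℂ‖ ≤ ‖p.1.1 n‖ * ‖A (p.2.1 n)‖ := norm_inner_le_norm _ _
    _ ≤ ‖p.1.1 n‖ * (‖A‖ * ‖p.2.1 n‖) := by gcongr; exact A.le_opNorm _
    _ = ‖A‖ * (‖p.1.1 n‖ * ‖p.2.1 n‖) := by ring
    _ ≤ ‖A‖ * (‖p.1.1 n‖ ^ 2 + ‖p.2.1 n‖ ^ 2) := by
      gcongr
      nlinarith [sq_nonneg (‖p.1.1 n‖ - ‖p.2.1 n‖), sq_nonneg ‖p.1.1 n‖, sq_nonneg ‖p.2.1 n‖]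

lemma normalFunctional_add (p : SqSummable H × SqSummable H) (A B : H →L[ℂ] H) :
    normalFunctional p (A + B) = normalFunctional p A + normalFunctional p B := by
  simp only [normalFunctional, add_apply, inner_add_right]
  exact (summable_inner p A).tsum_add (summable_inner p B)

lemma normalFunctional_smul (p : SqSummable H × SqSummable H) (c : ℂ) (A : H →L[ℂ] H) :
    normalFunctional p (c • A) = c * normalFunctional p A := by
  simp only [normalFunctional, smul_apply, inner_smul_right]
  exact tsum_mul_left

/-- The sequence `x, 0, 0, …`. -/
def single (x : H) : SqSummable H :=
  ⟨fun n => if n = 0 then x else 0,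
    summable_of_ne_finset_zero (s := {0}) fun n hn => by
      have : n ≠ 0 := by simpa using hn
      simp [this]⟩

lemma normalFunctional_single (x y : H) (A : H →L[ℂ] H) :
    normalFunctional (single x, single y) A = ⟪x, A y⟫_ℂ := by
  unfold normalFunctional
  rw [tsum_eq_single 0]
  · simp [single]
  · intro n hn
    simp [single, hn]

lemma TendstoSigmaWeak.unique {ι : Type*} {f : ι → H →L[ℂ] H} {l : Filter ι} [l.NeBot]
    {B C : H →L[ℂ] H} (hB : TendstoSigmaWeak f l B) (hC : TendstoSigmaWeak f l C) : B = C := by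
  rw [tendstoSigmaWeak_iff] at hB hC
  ext y
  refine ext_inner_left ℂ fun x => ?_
  rw [← normalFunctional_single, ← normalFunctional_single]
  exact tendsto_nhds_unique (hB _) (hC _)

lemma TendstoSigmaWeak.add {ι : Type*} {f g : ι → H →L[ℂ] H} {l : Filter ι} {B C : H →L[ℂ] H}
    (hB : TendstoSigmaWeak f l B) (hC : TendstoSigmaWeak g l C) :
    TendstoSigmaWeak (fun i => f i + g i) l (B + C) := by
  rw [tendstoSigmaWeak_iff] at *
  intro p
  simpa only [normalFunctional_add] using (hB p).add (hC p)

lemma TendstoSigmaWeak.smul {ι : Type*} {f : ι → H →L[ℂ] H} {l : Filter ι} {B : H →L[ℂ] H}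
    (c : ℂ) (hB : TendstoSigmaWeak f l B) : TendstoSigmaWeak (fun i => c • f i) l (c • B) := by
  rw [tendstoSigmaWeak_iff] at *
  intro p
  simpa only [normalFunctional_smul] using (hB p).const_mul c

variable [CompleteSpace H]

/-- A quantum Markov semigroup on the algebra of all bounded operators of `H`. -/
structure QuantumMarkovSemigroup (H : Type u) [NormedAddCommGroup H] [InnerProductSpace ℂ H]
    [CompleteSpace H] where
  /-- the completely positive linear map at time `t` -/
  map : ℝ≥0 → ((H →L[ℂ] H) →CP (H →L[ℂ] H))
  continuous_map : ∀ t, Continuous[sigmaWeak H, sigmaWeak H] (map t)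
  map_zero : ∀ A, map 0 A = A
  map_add : ∀ t s A, map (t + s) A = map t (map s A)
  continuous_time : ∀ A, Continuous[NNReal.instTopologicalSpace, sigmaWeak H] fun t => map t A
  map_one : ∀ t, map t 1 = 1

/-- The difference quotient `(T_t A - A) / t`. -/
def diffQuot (S : QuantumMarkovSemigroup H) (A : H →L[ℂ] H) (t : ℝ≥0) : H →L[ℂ] H :=
  ((t : ℝ) : ℂ)⁻¹ • (S.map t A - A)

lemma diffQuot_add (S : QuantumMarkovSemigroup H) (A B : H →L[ℂ] H) :
    diffQuot S (A + B) = fun t => diffQuot S A t + diffQuot S B t := by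
  funext t
  simp only [diffQuot, _root_.map_add, ← smul_add]
  congr 1
  abel

lemma diffQuot_smul (S : QuantumMarkovSemigroup H) (c : ℂ) (A : H →L[ℂ] H) :
    diffQuot S (c • A) = fun t => c • diffQuot S A t := by
  funext t
  simp only [diffQuot, _root_.map_smul, ← smul_sub]
  exact smul_comm _ _ _

/-- `A` lies in the domain of the generator and `B` is the value of the generator at `A`. In `ℝ≥0`
the filter `𝓝[≠] 0` is that of `t → 0` through `t > 0`. -/
def IsGeneratorAt (S : QuantumMarkovSemigroup H) (A B : H →L[ℂ] H) : Prop :=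
  TendstoSigmaWeak (diffQuot S A) (𝓝[≠] 0) B

lemma IsGeneratorAt.unique {S : QuantumMarkovSemigroup H} {A B C : H →L[ℂ] H}
    (hB : IsGeneratorAt S A B) (hC : IsGeneratorAt S A C) : B = C :=
  TendstoSigmaWeak.unique hB hC

lemma IsGeneratorAt.add {S : QuantumMarkovSemigroup H} {A A' B B' : H →L[ℂ] H}
    (h : IsGeneratorAt S A B) (h' : IsGeneratorAt S A' B') :
    IsGeneratorAt S (A + A') (B + B') := by
  unfold IsGeneratorAt
  rw [diffQuot_add]
  exact TendstoSigmaWeak.add h h'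

lemma IsGeneratorAt.smul {S : QuantumMarkovSemigroup H} {A B : H →L[ℂ] H} (c : ℂ)
    (h : IsGeneratorAt S A B) : IsGeneratorAt S (c • A) (c • B) := by
  unfold IsGeneratorAt
  rw [diffQuot_smul]
  exact TendstoSigmaWeak.smul c h

/-- The domain of the generator: all `A` for which `(T_t A - A) / t` converges `σ`-weakly as
`t → 0`. -/
def generatorDomain (S : QuantumMarkovSemigroup H) : Submodule ℂ (H →L[ℂ] H) where
  carrier := {A | ∃ B, IsGeneratorAt S A B}
  add_mem' := fun ⟨_, h⟩ ⟨_, h'⟩ => ⟨_, h.add h'⟩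
  zero_mem' := ⟨(0 : ℂ) • 0, by
    have : diffQuot S 0 = fun _ => 0 := by funext t; simp [diffQuot]
    unfold IsGeneratorAt
    rw [this, tendstoSigmaWeak_iff]
    intro p
    simp⟩
  smul_mem' := fun c _ ⟨_, h⟩ => ⟨_, h.smul c⟩

/-- The generator `L` of the semigroup, an unbounded operator with domain `generatorDomain S`. -/
def generator (S : QuantumMarkovSemigroup H) : (H →L[ℂ] H) →ₗ.[ℂ] (H →L[ℂ] H) where
  domain := generatorDomain S
  toFun :=
    { toFun := fun A => A.2.choose
      map_add' := fun A B =>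
        IsGeneratorAt.unique (A + B).2.choose_spec (A.2.choose_spec.add B.2.choose_spec)
      map_smul' := fun c A =>
        IsGeneratorAt.unique (c • A).2.choose_spec (A.2.choose_spec.smul c) }

lemma generator_spec (S : QuantumMarkovSemigroup H) (A : (generator S).domain) :
    IsGeneratorAt S A (generator S A) :=
  A.2.choose_spec

/-- The domain algebra: the largest `*`-subalgebra of the domain of the generator, as the supremum of
all `*`-subalgebras contained in the domain. -/
def domainAlgebra (S : QuantumMarkovSemigroup H) : StarSubalgebra ℂ (H →L[ℂ] H) :=
  sSup {B | (B : Set (H →L[ℂ] H)) ⊆ (generator S).domain}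

/-- `h` is an associate vector of the (nonzero) positive finite-rank operator `T`: writing
`T = ∑ₛ t'ₛ |k'ₛ⟩⟨k'ₛ|` with `k'` orthonormal and `t'ₛ > 0`, and putting `t = ∑ₛ t'ₛ`,
`kₛ = √t k'ₛ`, one has `h = ∑ₛ ‖kₛ‖⁻² kₛ`. -/
def IsAssociateVector (T : H →L[ℂ] H) (h : H) : Prop :=
  ∃ (m : ℕ) (t' : Fin m → ℝ) (k' k : Fin m → H),
    0 < m ∧ (∀ s, 0 < t' s) ∧ Orthonormal ℂ k' ∧
    T = ∑ s, (t' s : ℂ) • InnerProductSpace.rankOne ℂ (k' s) (k' s) ∧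
    (∀ s, k s = (√(∑ r, t' r) : ℂ) • k' s) ∧
    h = ∑ s, ((‖k s‖ ^ 2)⁻¹ : ℂ) • k s

/-- The subspace `{x | |x⟩⟨y| ∈ 𝒜}`. -/
def rankOneSubspace (𝒜 : StarSubalgebra ℂ (H →L[ℂ] H)) (y : H) : Submodule ℂ H where
  carrier := {x | InnerProductSpace.rankOne ℂ x y ∈ 𝒜}
  add_mem' := fun {a b} ha hb => by
    simpa only [Set.mem_ofPred_eq, _root_.map_add, add_apply] using add_mem ha hb
  zero_mem' := by
    simpa only [Set.mem_ofPred_eq, _root_.map_zero, zero_apply] using zero_mem 𝒜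
  smul_mem' := fun c x hx => by
    simpa only [Set.mem_ofPred_eq, _root_.map_smul, smul_apply] using SMulMemClass.smul_mem c hx

/-- The subspace `{x | |x⟩⟨y| ∈ 𝒜}` is invariant under `𝒜`: this is `A` acting on it. -/
def act {𝒜 : StarSubalgebra ℂ (H →L[ℂ] H)} {y : H} (A : 𝒜) (x : rankOneSubspace 𝒜 y) :
    rankOneSubspace 𝒜 y :=
  ⟨(A : H →L[ℂ] H) x, by
    have e : InnerProductSpace.rankOne ℂ ((A : H →L[ℂ] H) x) y
        = (A : H →L[ℂ] H) * InnerProductSpace.rankOne ℂ (x : H) y := by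
      ext z; simp
    change InnerProductSpace.rankOne ℂ ((A : H →L[ℂ] H) x) y ∈ 𝒜
    rw [e]
    exact mul_mem A.2 x.2⟩

end QMS

end

/-!
By the uniform boundedness principle and the strong continuity of the predual semigroup, `A` lies in
the domain of the generator exactly when its orbit is Lipschitz: `‖T_t A - A‖ = O(t)`. The defect
form `T_t(A* B) - T_t(A)* T_t(B)` is positive and satisfies a Cauchy-Schwarz inequality and a
Leibniz inequality, so the operators `A` with Lipschitz orbit for which the defects of `A` and `A*`
are `O(t)` form a `*`-algebra. It contains every `*`-subalgebra of the domain, hence the domain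
algebra, which is therefore contained in the domain.

Fix a unit vector `e` and let a completely positive map have Stinespring dilation
`φ(A) = V† π(A) V`. Subtracting from `φ(A)` the terms `G A + (G A*)*`, where
`G v = φ(|v⟩⟨e|) e - ½ ⟪e, φ(|e⟩⟨e|) e⟫ v`, leaves `W† π(A) W` with `W u = V u - π(|u⟩⟨e|) V e`.
Up to the factor `t⁻¹`, `(T_t - id) / t` leaves the same kernel as `T_t`, so this kernel is positive
definite too. Positive definiteness and the bound `‖π(A)‖ ≤ ‖A‖` pass to the limit `t → 0`, and the
GNS construction dilates the limit kernel; `e` is the normalization of `Th`.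
-/

noncomputable section

namespace QMS

section Kernels

universe v w

open scoped TensorProduct ComplexConjugate

section Completion

open UniformSpace (Completion)

variable {𝒜 : Type*} [NormedRing 𝒜] [StarRing 𝒜] [Algebra ℂ 𝒜]
  {E : Type*} [SeminormedAddCommGroup E] [InnerProductSpace ℂ E]

lemma clm_completion_ext {F : Type*} [NormedAddCommGroup F] [NormedSpace ℂ F]
    {f g : Completion E →L[ℂ] F} (h : ∀ x : E, f x = g x) : f = g :=
  DFunLike.coe_injective (Completion.ext f.continuous g.continuous h)

lemma norm_completion_le (f : E →L[ℂ] E) : ‖f.completion‖ ≤ ‖f‖ := by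
  refine ContinuousLinearMap.opNorm_le_bound _ (norm_nonneg f) fun x => ?_
  induction x using Completion.induction_on with
  | hp => apply isClosed_le <;> fun_prop
  | ih x => simpa using f.le_opNorm x

/-- The extension to the Hilbert space completion of a representation by bounded operators of a
pre-Hilbert space. Adjoints are only required to exist on the pre-Hilbert space, which need not be
separated. -/
def completionRep (r : 𝒜 →ₐ[ℂ] (E →L[ℂ] E))
    (hr : ∀ a x y, ⟪r a x, y⟫_ℂ = ⟪x, r (star a) y⟫_ℂ) :
    𝒜 →⋆ₐ[ℂ] (Completion E →L[ℂ] Completion E) where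
  toFun a := (r a).completion
  map_one' := clm_completion_ext fun x => by simp
  map_mul' a b := clm_completion_ext fun x => by simp
  map_zero' := clm_completion_ext fun x => by simp [Completion.coe_zero]
  map_add' a b := clm_completion_ext fun x => by simp [Completion.coe_add]
  commutes' c := clm_completion_ext fun x => by simp [Algebra.algebraMap_eq_smul_one]
  map_star' a := (ContinuousLinearMap.eq_adjoint_iff _ _).mpr fun x y => by
    induction x, y using Completion.induction_on₂ with
    | hp => apply isClosed_eq <;> fun_prop
    | ih x y => simp [hr]

lemma completionRep_apply_coe (r : 𝒜 →ₐ[ℂ] (E →L[ℂ] E))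
    (hr : ∀ a x y, ⟪r a x, y⟫_ℂ = ⟪x, r (star a) y⟫_ℂ) (a : 𝒜) (x : E) :
    completionRep r hr a x = (r a x : Completion E) :=
  (r a).completion_apply_coe x

theorem exists_completionRep {E : Type w} [AddCommGroup E] [Module ℂ E]
    (c : PreInnerProductSpace.Core ℂ E) (ρ : 𝒜 →ₐ[ℂ] Module.End ℂ E)
    (hadj : ∀ a x y, c.inner (ρ a x) y = c.inner x (ρ (star a) y))
    (hbdd : ∀ a x, (c.inner (ρ a x) (ρ a x)).re ≤ ‖a‖ ^ 2 * (c.inner x x).re) :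
    ∃ (K : Type w) (_ : NormedAddCommGroup K) (_ : InnerProductSpace ℂ K) (_ : CompleteSpace K)
      (π : 𝒜 →⋆ₐ[ℂ] (K →L[ℂ] K)) (ι : E →ₗ[ℂ] K),
      (∀ a, ‖π a‖ ≤ ‖a‖) ∧ (∀ x y, ⟪ι x, ι y⟫_ℂ = c.inner x y) ∧ ∀ a x, π a (ι x) = ι (ρ a x) := by
  let _ : SeminormedAddCommGroup E := InnerProductSpace.Core.toSeminormedAddCommGroup (c := c)
  let _ : InnerProductSpace ℂ E := InnerProductSpace.ofCore c
  have hnorm : ∀ a x, ‖ρ a x‖ ≤ ‖a‖ * ‖x‖ := fun a x => by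
    rw [← sq_le_sq₀ (by positivity) (by positivity), mul_pow,
      ← inner_self_eq_norm_sq (𝕜 := ℂ) (ρ a x), ← inner_self_eq_norm_sq (𝕜 := ℂ) x]
    exact hbdd a x
  let r : 𝒜 →ₐ[ℂ] (E →L[ℂ] E) :=
    { toFun := fun a => (ρ a).mkContinuous ‖a‖ (hnorm a)
      map_one' := by ext x; simp
      map_mul' := fun a b => by ext x; simp
      map_zero' := by ext x; simp
      map_add' := fun a b => by ext x; simp
      commutes' := fun z => by ext x; simp [Algebra.algebraMap_eq_smul_one] }
  exact ⟨Completion E, inferInstance, inferInstance, inferInstance, completionRep r hadj,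
    Completion.toComplₗᵢ.toLinearMap,
    fun a => (norm_completion_le (r a)).trans
      ((ρ a).mkContinuous_norm_le (norm_nonneg a) (hnorm a)),
    Completion.inner_coe, completionRep_apply_coe r hadj⟩

end Completion

section Energy

variable {𝒜 : Type*} [Mul 𝒜] [Star 𝒜] {U : Type*}

/-- The quadratic form `∑ β (p₁* a* a q₁) p₂ q₂` of a kernel, which for a dilated kernel is the
squared norm of `π(a) ∑ π(p₁) V p₂`. -/
def kernelEnergy (β : 𝒜 → U → U → ℂ) (a : 𝒜) (s : Finset (𝒜 × U)) : ℝ :=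
  (∑ p ∈ s, ∑ q ∈ s, β (star (a * p.1) * (a * q.1)) p.2 q.2).re

lemma tendsto_kernelEnergy {ι : Type*} {l : Filter ι} {f : ι → 𝒜 → U → U → ℂ}
    {β : 𝒜 → U → U → ℂ}
    (h : ∀ a u w, Tendsto (fun i => f i a u w) l (𝓝 (β a u w))) (a : 𝒜) (s : Finset (𝒜 × U)) :
    Tendsto (fun i => kernelEnergy (f i) a s) l (𝓝 (kernelEnergy β a s)) :=
  (Complex.continuous_re.tendsto _).comp <|
    tendsto_finsetSum _ fun _ _ => tendsto_finsetSum _ fun _ _ => h _ _ _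

end Energy

section LeftMul

variable {𝒜 : Type*} [Ring 𝒜] [Algebra ℂ 𝒜] {U : Type*} [AddCommGroup U] [Module ℂ U]

/-- Left multiplication on the first factor of `𝒜 ⊗ U`. -/
def leftMul : 𝒜 →ₐ[ℂ] Module.End ℂ (𝒜 ⊗[ℂ] U) :=
  (Module.End.rTensorAlgHom ℂ 𝒜 U).comp (Algebra.lmul ℂ 𝒜)

lemma leftMul_tmul (a b : 𝒜) (u : U) : leftMul a (b ⊗ₜ[ℂ] u) = (a * b) ⊗ₜ[ℂ] u := rfl

end LeftMul

variable {𝒜 : Type v} [NormedRing 𝒜] [StarRing 𝒜] [Algebra ℂ 𝒜]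
  {U : Type w} [AddCommGroup U] [Module ℂ U] {β : 𝒜 → U → U → ℂ}

/-- A dilation of an operator-valued kernel `β` on the `*`-algebra `𝒜`, given through its matrix
elements `β a u w`: a contractive `*`-representation `rep` on a Hilbert space `space` and a linear
map `map` with `β a u w = ⟪map u, rep a (map w)⟫`. -/
structure KernelDilation (β : 𝒜 → U → U → ℂ) where
  space : Type (max v w)
  [normedAddCommGroup : NormedAddCommGroup space]
  [innerProductSpace : InnerProductSpace ℂ space]
  [completeSpace : CompleteSpace space]
  rep : 𝒜 →⋆ₐ[ℂ] (space →L[ℂ] space)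
  norm_rep_le : ∀ a, ‖rep a‖ ≤ ‖a‖
  map : U →ₗ[ℂ] space
  apply_eq : ∀ a u w, β a u w = ⟪map u, rep a (map w)⟫_ℂ

attribute [instance] KernelDilation.normedAddCommGroup KernelDilation.innerProductSpace
  KernelDilation.completeSpace

namespace KernelDilation

lemma continuous_rep (d : KernelDilation β) : Continuous d.rep :=
  AddMonoidHomClass.continuous_of_bound d.rep 1 fun a => by simpa using d.norm_rep_le a

lemma inner_rep_mul (d : KernelDilation β) (a b : 𝒜) (u w : U) :
    ⟪d.rep a (d.map u), d.rep b (d.map w)⟫_ℂ = β (star a * b) u w := by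
  rw [d.apply_eq, map_mul, map_star, mul_apply_eq_comp, ContinuousLinearMap.star_eq_adjoint,
    ContinuousLinearMap.adjoint_inner_right]

/-- Positive multiples of dilated kernels are dilated by the same representation. -/
def smul (d : KernelDilation β) {r : ℝ} (hr : 0 ≤ r) :
    KernelDilation fun a u w => (r : ℂ) * β a u w where
  space := d.space
  rep := d.rep
  norm_rep_le := d.norm_rep_le
  map := (√r : ℂ) • d.map
  apply_eq a u w := by
    have hsq : (√r : ℂ) * √r = r := by rw [← Complex.ofReal_mul, Real.mul_self_sqrt hr]
    simp only [LinearMap.smul_apply, map_smul, inner_smul_left, inner_smul_right,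
      Complex.conj_ofReal, d.apply_eq, ← mul_assoc, hsq]

/-- The restriction of a dilation to a `*`-subalgebra and to a subspace of vectors. -/
def restrict [StarModule ℂ 𝒜] (d : KernelDilation β) (ℬ : StarSubalgebra ℂ 𝒜) (W : Submodule ℂ U) :
    KernelDilation fun (b : ℬ) (u w : W) => β b u w where
  space := d.space
  rep := d.rep.comp ℬ.subtype
  norm_rep_le b := d.norm_rep_le b
  map := d.map ∘ₗ W.subtype
  apply_eq b u w := d.apply_eq b u w

end KernelDilation

/-- A kernel is positive definite if it is hermitian and linear (hence conjugate linear in the first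
vector), has nonnegative quadratic form, and multiplication by `a` is bounded by `‖a‖` for that
form. -/
structure IsPositiveDefinite (β : 𝒜 → U → U → ℂ) : Prop where
  add_left : ∀ a b u w, β (a + b) u w = β a u w + β b u w
  smul_left : ∀ (c : ℂ) a u w, β (c • a) u w = c * β a u w
  add_right : ∀ a u w w', β a u (w + w') = β a u w + β a u w'
  smul_right : ∀ (c : ℂ) a u w, β a u (c • w) = c * β a u w
  star_left : ∀ a u w, β (star a) u w = conj (β a w u)
  energy_one_nonneg : ∀ s, 0 ≤ kernelEnergy β 1 s
  energy_le : ∀ a s, kernelEnergy β a s ≤ ‖a‖ ^ 2 * kernelEnergy β 1 s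

lemma KernelDilation.energy_eq (d : KernelDilation β) (a : 𝒜) (s : Finset (𝒜 × U)) :
    kernelEnergy β a s = ‖d.rep a (∑ p ∈ s, d.rep p.1 (d.map p.2))‖ ^ 2 := by
  rw [← inner_self_eq_norm_sq (𝕜 := ℂ), kernelEnergy, ← RCLike.re_to_complex]
  simp only [map_sum, sum_inner, inner_sum, ← d.inner_rep_mul, map_mul, mul_apply_eq_comp]
  exact Finset.sum_comm

lemma KernelDilation.isPositiveDefinite (d : KernelDilation β) : IsPositiveDefinite β where
  add_left a b u w := by simp only [d.apply_eq, map_add, add_apply, inner_add_right]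
  smul_left c a u w := by simp only [d.apply_eq, map_smul, smul_apply, inner_smul_right]
  add_right a u w w' := by simp only [d.apply_eq, map_add, inner_add_right]
  smul_right c a u w := by simp only [d.apply_eq, map_smul, inner_smul_right]
  star_left a u w := by
    rw [d.apply_eq, d.apply_eq, map_star, ContinuousLinearMap.star_eq_adjoint,
      ContinuousLinearMap.adjoint_inner_right, inner_conj_symm]
  energy_one_nonneg s := by rw [d.energy_eq]; positivity
  energy_le a s := by
    rw [d.energy_eq, d.energy_eq, map_one, one_apply_eq_self, ← mul_pow]
    gcongr
    exact (d.rep a).le_of_opNorm_le (d.norm_rep_le a) _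

lemma isPositiveDefinite_of_tendsto {ι : Type*} {l : Filter ι} [l.NeBot] {f : ι → 𝒜 → U → U → ℂ}
    (hf : ∀ᶠ i in l, IsPositiveDefinite (f i))
    (h : ∀ a u w, Tendsto (fun i => f i a u w) l (𝓝 (β a u w))) : IsPositiveDefinite β where
  add_left a b u w := tendsto_nhds_unique_of_eventuallyEq (h _ _ _) ((h a u w).add (h b u w)) <|
    hf.mono fun _ hi => hi.add_left a b u w
  smul_left c a u w := tendsto_nhds_unique_of_eventuallyEq (h _ _ _) ((h a u w).const_mul c) <|
    hf.mono fun _ hi => hi.smul_left c a u w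
  add_right a u w w' := tendsto_nhds_unique_of_eventuallyEq (h _ _ _) ((h a u w).add (h a u w')) <|
    hf.mono fun _ hi => hi.add_right a u w w'
  smul_right c a u w := tendsto_nhds_unique_of_eventuallyEq (h _ _ _) ((h a u w).const_mul c) <|
    hf.mono fun _ hi => hi.smul_right c a u w
  star_left a u w := tendsto_nhds_unique_of_eventuallyEq (h _ _ _)
    ((Complex.continuous_conj.tendsto _).comp (h a w u)) <| hf.mono fun _ hi => hi.star_left a u w
  energy_one_nonneg s := ge_of_tendsto (tendsto_kernelEnergy h 1 s) <|
    hf.mono fun _ hi => hi.energy_one_nonneg s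
  energy_le a s := le_of_tendsto_of_tendsto (tendsto_kernelEnergy h a s)
    ((tendsto_kernelEnergy h 1 s).const_mul _) <| hf.mono fun _ hi => hi.energy_le a s

namespace IsPositiveDefinite

lemma add_mid (h : IsPositiveDefinite β) (a : 𝒜) (u u' w : U) :
    β a (u + u') w = β a u w + β a u' w := by
  rw [← star_star a, h.star_left, h.add_right, map_add, ← h.star_left, ← h.star_left]

lemma smul_mid (h : IsPositiveDefinite β) (c : ℂ) (a : 𝒜) (u w : U) :
    β a (c • u) w = conj c * β a u w := by
  rw [← star_star a, h.star_left, h.smul_right, map_mul, ← h.star_left]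

variable [StarModule ℂ 𝒜]

/-- The sesquilinear form on `𝒜 ⊗ U` with `(a ⊗ u, b ⊗ w) ↦ β (a* b) u w`, whose Hilbert space
completion carries the dilation of `β`. -/
def form (h : IsPositiveDefinite β) : 𝒜 ⊗[ℂ] U →ₗ⋆[ℂ] 𝒜 ⊗[ℂ] U →ₗ[ℂ] ℂ :=
  TensorProduct.lift <| LinearMap.mk₂'ₛₗ (starRingEnd ℂ) (starRingEnd ℂ)
    (fun a u => TensorProduct.lift <| LinearMap.mk₂ ℂ (fun b w => β (star a * b) u w)
      (by simp [mul_add, h.add_left]) (by simp [h.smul_left])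
      (by simp [h.add_right]) (by simp [h.smul_right]))
    (by intros; ext; simp [add_mul, h.add_left]) (by intros; ext; simp [h.smul_left])
    (by intros; ext; simp [h.add_mid]) (by intros; ext; simp [h.smul_mid])

lemma form_tmul (h : IsPositiveDefinite β) (a b : 𝒜) (u w : U) :
    h.form (a ⊗ₜ u) (b ⊗ₜ w) = β (star a * b) u w := rfl

lemma form_conj_symm (h : IsPositiveDefinite β) (x y : 𝒜 ⊗[ℂ] U) :
    conj (h.form y x) = h.form x y := by
  induction x using TensorProduct.induction_on with
  | zero => simp
  | add x₁ x₂ h₁ h₂ => simp [h₁, h₂]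
  | tmul a u =>
    induction y using TensorProduct.induction_on with
    | zero => simp
    | add y₁ y₂ h₁ h₂ => simp [h₁, h₂]
    | tmul b w => simp [form_tmul, ← h.star_left]

lemma form_leftMul (h : IsPositiveDefinite β) (a : 𝒜) (x y : 𝒜 ⊗[ℂ] U) :
    h.form (leftMul a x) y = h.form x (leftMul (star a) y) := by
  induction x using TensorProduct.induction_on with
  | zero => simp
  | add x₁ x₂ h₁ h₂ => simp [h₁, h₂]
  | tmul b u =>
    induction y using TensorProduct.induction_on with
    | zero => simp
    | add y₁ y₂ h₁ h₂ => simp only [map_add, h₁, h₂]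
    | tmul d w => simp [leftMul_tmul, form_tmul, mul_assoc]

lemma re_form_leftMul_sum (h : IsPositiveDefinite β) (a : 𝒜) (s : Finset (𝒜 × U)) :
    (h.form (leftMul a (∑ p ∈ s, p.1 ⊗ₜ p.2)) (leftMul a (∑ p ∈ s, p.1 ⊗ₜ p.2))).re
      = kernelEnergy β a s := by
  simp only [map_sum, LinearMap.sum_apply, leftMul_tmul, form_tmul, kernelEnergy]
  rw [Finset.sum_comm]

/-- The positive semidefinite form `h.form` as the inner product of a pre-Hilbert space. -/
abbrev core (h : IsPositiveDefinite β) : PreInnerProductSpace.Core ℂ (𝒜 ⊗[ℂ] U) where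
  inner x y := h.form x y
  conj_inner_symm := h.form_conj_symm
  re_inner_nonneg x := by
    obtain ⟨s, rfl⟩ := TensorProduct.exists_finset x
    have := h.energy_one_nonneg s
    rwa [← h.re_form_leftMul_sum, map_one] at this
  add_left := by simp
  smul_left := by simp

lemma re_form_leftMul_le (h : IsPositiveDefinite β) (a : 𝒜) (x : 𝒜 ⊗[ℂ] U) :
    (h.form (leftMul a x) (leftMul a x)).re ≤ ‖a‖ ^ 2 * (h.form x x).re := by
  obtain ⟨s, rfl⟩ := TensorProduct.exists_finset x
  have := h.energy_le a s
  rwa [← h.re_form_leftMul_sum, ← h.re_form_leftMul_sum, map_one] at this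

theorem nonempty_kernelDilation (h : IsPositiveDefinite β) : Nonempty (KernelDilation β) := by
  obtain ⟨K, _, _, _, π, ι, hπ, hι, hπι⟩ :=
    exists_completionRep h.core leftMul h.form_leftMul h.re_form_leftMul_le
  refine ⟨{
    space := K
    rep := π
    norm_rep_le := hπ
    map := ι ∘ₗ TensorProduct.mk ℂ 𝒜 U 1
    apply_eq := fun a u w => ?_ }⟩
  simp only [LinearMap.comp_apply, hπι, hι, TensorProduct.mk_apply, leftMul_tmul]
  change _ = h.form _ _
  simp [form_tmul]

end IsPositiveDefinite

theorem nonempty_kernelDilation_of_tendsto [StarModule ℂ 𝒜] {ι : Type*} {l : Filter ι} [l.NeBot]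
    {f : ι → 𝒜 → U → U → ℂ} (hf : ∀ᶠ i in l, Nonempty (KernelDilation (f i)))
    (h : ∀ a u w, Tendsto (fun i => f i a u w) l (𝓝 (β a u w))) :
    Nonempty (KernelDilation β) :=
  (isPositiveDefinite_of_tendsto (hf.mono fun _ ⟨d⟩ => d.isPositiveDefinite)
    h).nonempty_kernelDilation

end Kernels

section Stinespring

open scoped ComplexOrder

universe v

section RowMatrix

variable {R : Type*} [NonUnitalNonAssocSemiring R] [StarRing R] {n : Type*} [DecidableEq n]

/-- The square matrix whose row `i₀` is `a` and whose other rows vanish. -/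
def rowMatrix (i₀ : n) (a : n → R) : CStarMatrix n n R :=
  CStarMatrix.ofMatrix fun k j => if k = i₀ then a j else 0

lemma star_rowMatrix_mul_self [Fintype n] (i₀ : n) (a : n → R) (i j : n) :
    (star (rowMatrix i₀ a) * rowMatrix i₀ a) i j = star (a i) * a j := by
  have hrow : ∀ k j, rowMatrix i₀ a k j = if k = i₀ then a j else 0 := fun _ _ => rfl
  simp [CStarMatrix.mul_apply, CStarMatrix.star_apply, hrow]

end RowMatrix

variable {𝒜 : Type v} [CStarAlgebra 𝒜] [PartialOrder 𝒜] [StarOrderedRing 𝒜]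

lemma kernelEnergy_le_of_nonneg {U : Type*} {β : 𝒜 → U → U → ℂ}
    (hadd : ∀ a b u w, β (a + b) u w = β a u w + β b u w)
    (hsmul : ∀ (c : ℂ) a u w, β (c • a) u w = c * β a u w)
    (hnonneg : ∀ a s, 0 ≤ kernelEnergy β a s) (a : 𝒜) (s : Finset (𝒜 × U)) :
    kernelEnergy β a s ≤ ‖a‖ ^ 2 * kernelEnergy β 1 s := by
  obtain ⟨c, hc⟩ := CStarAlgebra.nonneg_iff_eq_star_mul_self.mp
    (sub_nonneg.mpr (CStarAlgebra.star_mul_le_algebraMap_norm_sq (a := a)))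
  have hβ : ∀ p q : 𝒜 × U, β (star (c * p.1) * (c * q.1)) p.2 q.2
      + β (star (a * p.1) * (a * q.1)) p.2 q.2
        = ((‖a‖ ^ 2 : ℝ) : ℂ) * β (star (1 * p.1) * (1 * q.1)) p.2 q.2 := fun p q => by
    rw [← hadd, ← hsmul, Complex.coe_smul]
    congr 1
    calc star (c * p.1) * (c * q.1) + star (a * p.1) * (a * q.1)
        = star p.1 * (star c * c + star a * a) * q.1 := by
          simp only [star_mul, mul_add, add_mul, mul_assoc]
      _ = (‖a‖ ^ 2 : ℝ) • (star (1 * p.1) * (1 * q.1)) := by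
          rw [← hc, sub_add_cancel, Algebra.algebraMap_eq_smul_one]
          simp
  have hsum : kernelEnergy β c s + kernelEnergy β a s = ‖a‖ ^ 2 * kernelEnergy β 1 s := by
    simp only [kernelEnergy, ← Complex.add_re, ← Finset.sum_add_distrib, hβ, ← Finset.mul_sum,
      Complex.re_ofReal_mul]
  linarith [hnonneg c s]

variable {H : Type u} [NormedAddCommGroup H] [InnerProductSpace ℂ H] [CompleteSpace H]

lemma sum_inner_star_mul_self_nonneg {n : Type*} [Fintype n] (N : CStarMatrix n n (H →L[ℂ] H))
    (x : n → H) : 0 ≤ ∑ i, ∑ j, ⟪x i, (star N * N) i j (x j)⟫_ℂ := by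
  have hN : ∀ i j, ⟪x i, (star N * N) i j (x j)⟫_ℂ = ∑ k, ⟪N k i (x i), N k j (x j)⟫_ℂ :=
    fun i j => by
      simp only [CStarMatrix.mul_apply, CStarMatrix.star_apply, sum_apply, mul_apply_eq_comp,
        inner_sum, ContinuousLinearMap.star_eq_adjoint, ContinuousLinearMap.adjoint_inner_right]
  calc (0 : ℂ) ≤ ∑ k, ⟪∑ i, N k i (x i), ∑ j, N k j (x j)⟫_ℂ :=
        Finset.sum_nonneg fun k _ => by rw [inner_self_eq_norm_sq_to_K]; positivity
    _ = ∑ k, ∑ i, ∑ j, ⟪N k i (x i), N k j (x j)⟫_ℂ := by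
        simp only [sum_inner, inner_sum]
        exact Finset.sum_congr rfl fun k _ => Finset.sum_comm
    _ = ∑ i, ∑ j, ∑ k, ⟪N k i (x i), N k j (x j)⟫_ℂ := by
        rw [Finset.sum_comm]
        exact Finset.sum_congr rfl fun i _ => Finset.sum_comm
    _ = ∑ i, ∑ j, ⟪x i, (star N * N) i j (x j)⟫_ℂ := by simp only [hN]

lemma sum_inner_nonneg_of_cstarMatrix_nonneg {n : Type*} [Fintype n]
    {M : CStarMatrix n n (H →L[ℂ] H)} (hM : 0 ≤ M) (x : n → H) :
    0 ≤ ∑ i, ∑ j, ⟪x i, M i j (x j)⟫_ℂ := by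
  rw [StarOrderedRing.nonneg_iff] at hM
  induction hM using AddSubmonoid.closure_induction with
  | zero => simp [CStarMatrix.zero_apply]
  | add M N _ _ hM hN =>
    simpa only [CStarMatrix.add_apply, add_apply, inner_add_right, Finset.sum_add_distrib]
      using add_nonneg hM hN
  | mem M hM =>
    obtain ⟨N, rfl⟩ := hM
    exact sum_inner_star_mul_self_nonneg N x

lemma sum_inner_map_nonneg (φ : 𝒜 →CP (H →L[ℂ] H)) {n : Type*} [Fintype n]
    (a : n → 𝒜) (x : n → H) :
    0 ≤ ∑ i, ∑ j, ⟪x i, φ (star (a i) * a j) (x j)⟫_ℂ := by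
  classical
  rcases isEmpty_or_nonempty n with _ | ⟨⟨i₀⟩⟩
  · simp
  have := sum_inner_nonneg_of_cstarMatrix_nonneg
    (φ.map_cstarMatrix_nonneg _ (star_mul_self_nonneg (rowMatrix i₀ a))) x
  simpa only [CStarMatrix.map_apply, star_rowMatrix_mul_self] using this

lemma map_star_eq (φ : 𝒜 →CP (H →L[ℂ] H)) (a : 𝒜) : φ (star a) = star (φ a) :=
  map_star (PositiveLinearMap.ofClass φ) a

lemma inner_map_star (φ : 𝒜 →CP (H →L[ℂ] H)) (a : 𝒜) (x y : H) :
    ⟪x, φ (star a) y⟫_ℂ = ⟪φ a x, y⟫_ℂ := by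
  rw [map_star_eq, ContinuousLinearMap.star_eq_adjoint, ContinuousLinearMap.adjoint_inner_right]

lemma isPositiveDefinite_completelyPositiveMap (φ : 𝒜 →CP (H →L[ℂ] H)) :
    IsPositiveDefinite fun a (u w : H) => ⟪u, φ a w⟫_ℂ := by
  have hadd : ∀ a b (u w : H), ⟪u, φ (a + b) w⟫_ℂ = ⟪u, φ a w⟫_ℂ + ⟪u, φ b w⟫_ℂ := by
    simp
  have hsmul : ∀ (c : ℂ) a (u w : H), ⟪u, φ (c • a) w⟫_ℂ = c * ⟪u, φ a w⟫_ℂ := by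
    simp
  have hnonneg : ∀ a s, 0 ≤ kernelEnergy (fun a (u w : H) => ⟪u, φ a w⟫_ℂ) a s := fun a s => by
    have := sum_inner_map_nonneg φ (fun p : s => a * p.1.1) fun p => p.1.2
    have hs : ∀ f : 𝒜 × H → 𝒜 × H → ℂ, ∑ p : s, ∑ q : s, f p q = ∑ p ∈ s, ∑ q ∈ s, f p q :=
      fun f => by
        rw [← Finset.sum_coe_sort s]
        exact Finset.sum_congr rfl fun p _ => Finset.sum_coe_sort s _
    rw [hs fun p q => ⟪p.2, φ (star (a * p.1) * (a * q.1)) q.2⟫_ℂ] at this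
    exact (Complex.le_def.mp this).1
  exact {
    add_left := hadd
    smul_left := hsmul
    add_right := fun a u w w' => by simp
    smul_right := fun c a u w => by simp
    star_left := fun a u w => by rw [inner_map_star, inner_conj_symm]
    energy_one_nonneg := hnonneg 1
    energy_le := kernelEnergy_le_of_nonneg hadd hsmul hnonneg }

theorem nonempty_stinespring (φ : 𝒜 →CP (H →L[ℂ] H)) :
    Nonempty (KernelDilation fun a (u w : H) => ⟪u, φ a w⟫_ℂ) :=
  (isPositiveDefinite_completelyPositiveMap φ).nonempty_kernelDilation

end Stinespring

section UnitalCompletelyPositive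

open ContinuousLinearMap (adjoint)

universe v w

namespace KernelDilation

variable {𝒜 : Type v} [NormedRing 𝒜] [StarRing 𝒜] [Algebra ℂ 𝒜]

lemma norm_rep_sq_of_isStarProjection {U : Type w} [AddCommGroup U] [Module ℂ U]
    {β : 𝒜 → U → U → ℂ} (d : KernelDilation β) {p : 𝒜} (hp : IsStarProjection p) (u : U) :
    ‖d.rep p (d.map u)‖ ^ 2 = (β p u u).re := by
  rw [← inner_self_eq_norm_sq (𝕜 := ℂ), d.inner_rep_mul, hp.isSelfAdjoint.star_eq,
    hp.isIdempotentElem.eq, RCLike.re_to_complex]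

variable {H : Type w} [NormedAddCommGroup H] [InnerProductSpace ℂ H] {β : 𝒜 → H → H → ℂ}

/-- The Stinespring isometry of a kernel that is unital, that is, takes the inner product as its
value at `1`. -/
def isometry (d : KernelDilation β) (hβ : ∀ x y, β 1 x y = ⟪x, y⟫_ℂ) : H →ₗᵢ[ℂ] d.space :=
  d.map.isometryOfInner fun x y => by rw [← hβ, d.apply_eq, map_one, one_apply_eq_self]

end KernelDilation

variable {𝒜 : Type v} [CStarAlgebra 𝒜] [PartialOrder 𝒜] [StarOrderedRing 𝒜]
  {H : Type u} [NormedAddCommGroup H] [InnerProductSpace ℂ H] [CompleteSpace H]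
  {φ : 𝒜 →CP (H →L[ℂ] H)}

lemma exists_stinespring_isometry (hφ : φ 1 = 1) :
    ∃ (K : Type (max u v)) (_ : NormedAddCommGroup K) (_ : InnerProductSpace ℂ K)
      (_ : CompleteSpace K) (π : 𝒜 →⋆ₐ[ℂ] (K →L[ℂ] K)) (V : H →L[ℂ] K),
      (∀ a, ‖π a‖ ≤ ‖a‖) ∧ ‖V‖ ≤ 1 ∧ (∀ x, adjoint V (V x) = x) ∧
      ∀ a x, adjoint V (π a (V x)) = φ a x := by
  obtain ⟨d⟩ := nonempty_stinespring φ
  have hone : ∀ x y, ⟪x, φ 1 y⟫_ℂ = ⟪x, y⟫_ℂ := fun x y => by rw [hφ, one_apply_eq_self]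
  set V := d.isometry hone
  refine ⟨d.space, inferInstance, inferInstance, inferInstance, d.rep,
    V.toContinuousLinearMap, d.norm_rep_le, V.norm_toContinuousLinearMap_le,
    fun x => ext_inner_left ℂ fun y => ?_, fun a x => ext_inner_left ℂ fun y => ?_⟩ <;>
    rw [ContinuousLinearMap.adjoint_inner_right]
  · exact V.inner_map_map y x
  · exact (d.apply_eq a y x).symm

lemma norm_map_le (hφ : φ 1 = 1) (a : 𝒜) : ‖φ a‖ ≤ ‖a‖ := by
  obtain ⟨K, _, _, _, π, V, hπ, hV, -, hφV⟩ := exists_stinespring_isometry hφ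
  have hφa : φ a = adjoint V ∘L π a ∘L V := by ext x; exact (hφV a x).symm
  have hV' : ‖adjoint V‖ ≤ 1 := by rwa [LinearIsometryEquiv.norm_map]
  calc ‖φ a‖ ≤ ‖adjoint V‖ * (‖π a‖ * ‖V‖) := by
        grw [hφa, ContinuousLinearMap.opNorm_comp_le, ContinuousLinearMap.opNorm_comp_le]
    _ ≤ 1 * (‖a‖ * 1) := by gcongr; exact hπ a
    _ = ‖a‖ := by ring

/-- The failure of multiplicativity of `φ`, as an operator-valued sesquilinear form. -/
def defect (φ : 𝒜 →CP (H →L[ℂ] H)) (a b : 𝒜) : H →L[ℂ] H :=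
  φ (star a * b) - star (φ a) * φ b

/-- The seminorm of the positive semidefinite form `defect φ`. -/
def defectNorm (φ : 𝒜 →CP (H →L[ℂ] H)) (a : 𝒜) : ℝ := √‖defect φ a a‖

section DefectMap

variable {K : Type*} [NormedAddCommGroup K] [InnerProductSpace ℂ K] [CompleteSpace K]
  {π : 𝒜 →⋆ₐ[ℂ] (K →L[ℂ] K)} {V : H →L[ℂ] K}

lemma isStarProjection_one_sub_comp_adjoint (hVV : ∀ x, adjoint V (V x) = x) :
    IsStarProjection (1 - V ∘L adjoint V) :=
  IsStarProjection.one_sub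
    ⟨by ext x; simp [hVV],
      by simp [isSelfAdjoint_iff, ContinuousLinearMap.star_eq_adjoint,
        ContinuousLinearMap.adjoint_comp]⟩

variable (π V) in
/-- The part `(1 - V V†) π(a) V` of a Stinespring dilation `φ a = V† π(a) V` that measures the
failure of multiplicativity of `φ`. -/
def defectMap : 𝒜 →ₗ[ℂ] (H →L[ℂ] K) where
  toFun a := (1 - V ∘L adjoint V) ∘L π a ∘L V
  map_add' a b := by ext; simp
  map_smul' c a := by ext; simp

lemma defectMap_apply (hφV : ∀ a x, adjoint V (π a (V x)) = φ a x) (a : 𝒜) (x : H) :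
    defectMap π V a x = π a (V x) - V (φ a x) := by
  simp [defectMap, hφV]

lemma adjoint_rep_rep (hφV : ∀ a x, adjoint V (π a (V x)) = φ a x) (a b : 𝒜) (x : H) :
    adjoint V (π a (π b (V x))) = φ (a * b) x := by
  rw [← hφV, map_mul, mul_apply_eq_comp]

lemma defect_eq_adjoint_comp (hφV : ∀ a x, adjoint V (π a (V x)) = φ a x)
    (hVV : ∀ x, adjoint V (V x) = x) (a b : 𝒜) :
    defect φ a b = adjoint (defectMap π V a) ∘L defectMap π V b := by
  set Q := 1 - V ∘L adjoint V
  have hQ : IsStarProjection Q := isStarProjection_one_sub_comp_adjoint hVV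
  have hadj : adjoint (defectMap π V a) = adjoint V ∘L π (star a) ∘L Q := by
    rw [map_star, ← hQ.isSelfAdjoint.star_eq, ContinuousLinearMap.star_eq_adjoint,
      ContinuousLinearMap.star_eq_adjoint, ← ContinuousLinearMap.adjoint_comp,
      ← ContinuousLinearMap.adjoint_comp]
    rfl
  ext x
  have hQR : Q (defectMap π V b x) = defectMap π V b x :=
    DFunLike.congr_fun hQ.isIdempotentElem.eq (π b (V x))
  rw [hadj, ContinuousLinearMap.comp_apply, ContinuousLinearMap.comp_apply,
    ContinuousLinearMap.comp_apply, hQR, defectMap_apply hφV, map_sub, map_sub,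
    adjoint_rep_rep hφV, hφV, map_star_eq, defect, sub_apply, mul_apply_eq_comp]

lemma norm_defectMap_mul_le (hφV : ∀ a x, adjoint V (π a (V x)) = φ a x) (hφ : φ 1 = 1)
    (hVV : ∀ x, adjoint V (V x) = x) (hπ : ∀ a, ‖π a‖ ≤ ‖a‖) (a b : 𝒜) :
    ‖defectMap π V (a * b)‖ ≤ ‖defectMap π V a‖ * ‖b‖ + ‖a‖ * ‖defectMap π V b‖ := by
  set Q := 1 - V ∘L adjoint V with hQ_def
  have hmul : defectMap π V (a * b) = defectMap π V a ∘L φ b + Q ∘L π a ∘L defectMap π V b := by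
    ext x
    simp only [hQ_def, defectMap_apply hφV, add_apply, sub_apply, ContinuousLinearMap.comp_apply,
      map_sub, map_mul, mul_apply_eq_comp, one_apply_eq_self, adjoint_rep_rep hφV, hφV]
    abel
  calc ‖defectMap π V (a * b)‖
      ≤ ‖defectMap π V a‖ * ‖φ b‖ + ‖Q‖ * (‖π a‖ * ‖defectMap π V b‖) := by
        grw [hmul, norm_add_le, ContinuousLinearMap.opNorm_comp_le,
          ContinuousLinearMap.opNorm_comp_le, ContinuousLinearMap.opNorm_comp_le]
    _ ≤ ‖defectMap π V a‖ * ‖b‖ + 1 * (‖a‖ * ‖defectMap π V b‖) := by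
        gcongr
        exacts [norm_map_le hφ b, (isStarProjection_one_sub_comp_adjoint hVV).norm_le, hπ a]
    _ = ‖defectMap π V a‖ * ‖b‖ + ‖a‖ * ‖defectMap π V b‖ := by ring

end DefectMap

lemma exists_defect_factorization (hφ : φ 1 = 1) :
    ∃ (K : Type (max u v)) (_ : NormedAddCommGroup K) (_ : InnerProductSpace ℂ K)
      (_ : CompleteSpace K) (R : 𝒜 →ₗ[ℂ] (H →L[ℂ] K)),
      (∀ a b, defect φ a b = adjoint (R a) ∘L R b) ∧ (∀ a, defectNorm φ a = ‖R a‖) ∧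
      ∀ a b, ‖R (a * b)‖ ≤ ‖R a‖ * ‖b‖ + ‖a‖ * ‖R b‖ := by
  obtain ⟨K, _, _, _, π, V, hπ, -, hVV, hφV⟩ := exists_stinespring_isometry hφ
  have hdefect := defect_eq_adjoint_comp hφV hVV
  refine ⟨K, inferInstance, inferInstance, inferInstance, defectMap π V, hdefect, fun a => ?_,
    norm_defectMap_mul_le hφV hφ hVV hπ⟩
  rw [defectNorm, hdefect, ContinuousLinearMap.norm_adjoint_comp_self,
    Real.sqrt_mul_self (norm_nonneg _)]

lemma norm_defect_le (hφ : φ 1 = 1) (a b : 𝒜) :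
    ‖defect φ a b‖ ≤ defectNorm φ a * defectNorm φ b := by
  obtain ⟨K, _, _, _, R, hdefect, hnorm, -⟩ := exists_defect_factorization hφ
  rw [hdefect, hnorm, hnorm, ← LinearIsometryEquiv.norm_map adjoint (R a)]
  exact ContinuousLinearMap.opNorm_comp_le _ _

lemma defectNorm_add_le (hφ : φ 1 = 1) (a b : 𝒜) :
    defectNorm φ (a + b) ≤ defectNorm φ a + defectNorm φ b := by
  obtain ⟨K, _, _, _, R, -, hnorm, -⟩ := exists_defect_factorization hφ
  simpa only [hnorm, map_add] using norm_add_le (R a) (R b)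

lemma defectNorm_mul_le (hφ : φ 1 = 1) (a b : 𝒜) :
    defectNorm φ (a * b) ≤ defectNorm φ a * ‖b‖ + ‖a‖ * defectNorm φ b := by
  obtain ⟨K, _, _, _, R, -, hnorm, hmul⟩ := exists_defect_factorization hφ
  simpa only [hnorm] using hmul a b

lemma defectNorm_algebraMap (hφ : φ 1 = 1) (c : ℂ) : defectNorm φ (algebraMap ℂ 𝒜 c) = 0 := by
  simp [defectNorm, defect, Algebra.algebraMap_eq_smul_one, hφ]

end UnitalCompletelyPositive

section VectorState

open InnerProductSpace (rankOne)

lemma norm_inner_apply_self_sub_le {E : Type*} [NormedAddCommGroup E] [InnerProductSpace ℂ E]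
    (Y : E →L[ℂ] E) {v p : E} (hv : ‖v‖ ≤ 1) (hp : ‖p‖ ≤ 1) :
    ‖⟪v, Y v⟫_ℂ - ⟪p, Y p⟫_ℂ‖ ≤ 2 * ‖v - p‖ * ‖Y‖ :=
  calc ‖⟪v, Y v⟫_ℂ - ⟪p, Y p⟫_ℂ‖ = ‖⟪v - p, Y v⟫_ℂ + ⟪p, Y (v - p)⟫_ℂ‖ := by
        rw [map_sub, inner_sub_left, inner_sub_right]
        congr 1
        ring
    _ ≤ ‖v - p‖ * (‖Y‖ * ‖v‖) + ‖p‖ * (‖Y‖ * ‖v - p‖) := by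
        grw [norm_add_le, norm_inner_le_norm, norm_inner_le_norm, Y.le_opNorm, Y.le_opNorm]
    _ ≤ ‖v - p‖ * (‖Y‖ * 1) + 1 * (‖Y‖ * ‖v - p‖) := by gcongr
    _ = 2 * ‖v - p‖ * ‖Y‖ := by ring

variable {H : Type u} [NormedAddCommGroup H] [InnerProductSpace ℂ H]

lemma rankOne_mul_mul_rankOne (x y z w : H) (X : H →L[ℂ] H) :
    rankOne ℂ x y * (X * rankOne ℂ z w) = ⟪y, X z⟫_ℂ • rankOne ℂ x w := by
  ext v
  simp [smul_smul, mul_comm]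

variable [CompleteSpace H]

-- In a Stinespring dilation `φ = V† π V` the hypothesis says that `π(|x⟩⟨x|)` nearly fixes `V x`.
lemma norm_inner_map_sub_le {φ : (H →L[ℂ] H) →CP (H →L[ℂ] H)} (hφ : φ 1 = 1) {x : H}
    (hx : ‖x‖ = 1) {η : ℝ} (hη : ‖1 - ⟪x, φ (rankOne ℂ x x) x⟫_ℂ‖ ≤ η) (X : H →L[ℂ] H) :
    ‖⟪x, φ X x⟫_ℂ - ⟪x, X x⟫_ℂ‖ ≤ (2 * √η + η) * ‖X‖ := by
  obtain ⟨d⟩ := nonempty_stinespring φ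
  set P := rankOne ℂ x x
  set v := d.map x
  set p := d.rep P v
  have hP : IsStarProjection P := InnerProductSpace.isStarProjection_rankOne_self hx
  have hv : ‖v‖ = 1 :=
    ((d.isometry fun _ _ => by rw [hφ, one_apply_eq_self]).norm_map x).trans hx
  have hp : ‖p‖ ≤ 1 :=
    calc ‖p‖ ≤ ‖P‖ * ‖v‖ := by grw [← d.norm_rep_le P]; exact (d.rep P).le_opNorm v
      _ ≤ 1 := by grw [hP.norm_le, hv, one_mul]
  have hvp : ‖v - p‖ ≤ √η := by
    refine Real.le_sqrt_of_sq_le (le_trans ?_ hη)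
    have h := d.norm_rep_sq_of_isStarProjection hP.one_sub x
    rw [map_sub, map_one, sub_apply, one_apply_eq_self, map_sub, hφ, sub_apply, one_apply_eq_self,
      inner_sub_right, inner_self_eq_norm_sq_to_K, hx] at h
    simpa [v, p, h] using Complex.re_le_norm (1 - ⟪x, φ P x⟫_ℂ)
  have hpp : ⟪p, d.rep X p⟫_ℂ = ⟪x, X x⟫_ℂ * ⟪x, φ P x⟫_ℂ := by
    rw [← mul_apply_eq_comp, ← map_mul, d.inner_rep_mul, hP.isSelfAdjoint.star_eq,
      rankOne_mul_mul_rankOne, map_smul, smul_apply, inner_smul_right]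
  have hXx : ‖⟪x, X x⟫_ℂ‖ ≤ ‖X‖ := by
    grw [norm_inner_le_norm, X.le_opNorm, hx, one_mul, mul_one]
  calc ‖⟪x, φ X x⟫_ℂ - ⟪x, X x⟫_ℂ‖
      = ‖(⟪v, d.rep X v⟫_ℂ - ⟪p, d.rep X p⟫_ℂ) - ⟪x, X x⟫_ℂ * (1 - ⟪x, φ P x⟫_ℂ)‖ := by
        rw [← d.apply_eq, hpp]
        congr 1
        ring
    _ ≤ 2 * ‖v - p‖ * ‖d.rep X‖ + ‖⟪x, X x⟫_ℂ‖ * ‖1 - ⟪x, φ P x⟫_ℂ‖ := by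
        grw [norm_sub_le, norm_mul, norm_inner_apply_self_sub_le _ hv.le hp]
    _ ≤ 2 * √η * ‖X‖ + ‖X‖ * η := by gcongr; exact d.norm_rep_le X
    _ = (2 * √η + η) * ‖X‖ := by ring

end VectorState

section Generator

open InnerProductSpace (rankOne)

lemma exists_tendsto_of_forall_eventually_dist_le {ι E : Type*} [PseudoMetricSpace E]
    [CompleteSpace E] {l : Filter ι} [l.NeBot] {f : ι → E}
    (h : ∀ ε > 0, ∃ (g : ι → E) (z : E), Tendsto g l (𝓝 z) ∧ ∀ᶠ i in l, dist (f i) (g i) ≤ ε) :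
    ∃ z, Tendsto f l (𝓝 z) := by
  refine cauchy_map_iff_exists_tendsto.mp (Metric.cauchy_iff.mpr ⟨inferInstance, fun ε hε => ?_⟩)
  obtain ⟨g, z, hgz, hfg⟩ := h (ε / 4) (by positivity)
  have hfz : ∀ᶠ i in l, dist (f i) z < ε / 2 := by
    filter_upwards [hfg, Metric.tendsto_nhds.mp hgz (ε / 4) (by positivity)] with i hi hi'
    linarith [dist_triangle (f i) (g i) z]
  refine ⟨Metric.ball z (ε / 2), hfz, fun a ha b hb => ?_⟩
  linarith [dist_triangle_right a b z, Metric.mem_ball.mp ha, Metric.mem_ball.mp hb]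

lemma tendsto_integral_slope {E : Type*} [NormedAddCommGroup E] [NormedSpace ℝ E] [CompleteSpace E]
    {f : ℝ → E} (hf : Continuous f) (s : ℝ) :
    Tendsto (fun t => ∫ r in (0 : ℝ)..s, t⁻¹ • (f (r + t) - f r)) (𝓝[≠] 0) (𝓝 (f s - f 0)) := by
  have hderiv : ∀ a, Tendsto (fun t => t⁻¹ • ((∫ r in 0..a + t, f r) - ∫ r in 0..a, f r)) (𝓝[≠] 0)
      (𝓝 (f a)) := fun a => (hf.integral_hasStrictDerivAt 0 a).hasDerivAt.tendsto_slope_zero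
  refine ((hderiv s).sub (hderiv 0)).congr fun t => ?_
  have hint : ∀ a b, IntervalIntegrable f MeasureTheory.volume a b := hf.intervalIntegrable
  have hint_add : IntervalIntegrable (fun r => f (r + t)) MeasureTheory.volume 0 s :=
    (hf.comp (continuous_add_const t)).intervalIntegrable 0 s
  rw [intervalIntegral.integral_smul, intervalIntegral.integral_sub hint_add (hint 0 s),
    intervalIntegral.integral_comp_add_right, zero_add,
    ← intervalIntegral.integral_interval_sub_left (hint 0 (s + t)) (hint 0 t),
    intervalIntegral.integral_same, ← smul_sub]
  congr 1
  abel

lemma norm_smul_integral_sub_le {E : Type*} [NormedAddCommGroup E] [NormedSpace ℝ E]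
    [CompleteSpace E] {g : ℝ → E} {s C : ℝ} (hs : 0 < s) (hg : Continuous g) {c : E}
    (h : ∀ r ∈ Set.Icc 0 s, ‖g r - c‖ ≤ C) : ‖s⁻¹ • (∫ r in (0 : ℝ)..s, g r) - c‖ ≤ C := by
  have havg : s⁻¹ • (∫ r in (0 : ℝ)..s, g r) - c = s⁻¹ • ∫ r in (0 : ℝ)..s, (g r - c) := by
    rw [intervalIntegral.integral_sub (hg.intervalIntegrable 0 s) intervalIntegrable_const,
      intervalIntegral.integral_const, sub_zero, smul_sub, inv_smul_smul₀ hs.ne']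
  have hbound := intervalIntegral.norm_integral_le_of_norm_le_const (a := 0) (b := s)
    (f := fun r => g r - c) fun r hr =>
      h r (Set.Ioc_subset_Icc_self (Set.uIoc_of_le hs.le ▸ hr))
  rw [sub_zero, abs_of_pos hs, mul_comm] at hbound
  rw [havg, norm_smul, norm_inv, Real.norm_of_nonneg hs.le, inv_mul_le_iff₀ hs]
  exact hbound

lemma exists_norm_le_of_forall_inner {ι E F : Type*} [NormedAddCommGroup E] [NormedSpace ℂ E]
    [CompleteSpace E] [NormedAddCommGroup F] [InnerProductSpace ℂ F] [CompleteSpace F]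
    {f : ι → E →L[ℂ] F} (h : ∀ x y, ∃ C, ∀ i, ‖⟪x, f i y⟫_ℂ‖ ≤ C) : ∃ C, ∀ i, ‖f i‖ ≤ C := by
  refine banach_steinhaus fun y => ?_
  obtain ⟨C, hC⟩ := banach_steinhaus (g := fun i => innerSL ℂ (f i y)) fun x => by
    obtain ⟨C, hC⟩ := h x y
    exact ⟨C, fun i => by rw [innerSL_apply_apply, norm_inner_symm]; exact hC i⟩
  exact ⟨C, fun i => by simpa using hC i⟩

variable {H : Type u} [NormedAddCommGroup H] [InnerProductSpace ℂ H]

lemma TendstoSigmaWeak.inner {ι : Type*} {f : ι → H →L[ℂ] H} {l : Filter ι} {B : H →L[ℂ] H}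
    (h : TendstoSigmaWeak f l B) (x y : H) :
    Tendsto (fun i => ⟪x, f i y⟫_ℂ) l (𝓝 ⟪x, B y⟫_ℂ) := by
  simpa only [normalFunctional_single] using tendstoSigmaWeak_iff.mp h (single x, single y)

lemma norm_inner_apply_le (A : H →L[ℂ] H) (x y : H) : ‖⟪x, A y⟫_ℂ‖ ≤ ‖A‖ * (‖x‖ * ‖y‖) := by
  grw [norm_inner_le_norm, A.le_opNorm]
  exact (mul_left_comm _ _ _).le

lemma inner_apply_polarization (A : H →L[ℂ] H) (x y : H) :
    ⟪x, A y⟫_ℂ = (⟪x + y, A (x + y)⟫_ℂ - ⟪x - y, A (x - y)⟫_ℂ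
      - Complex.I * (⟪x + Complex.I • y, A (x + Complex.I • y)⟫_ℂ
        - ⟪x - Complex.I • y, A (x - Complex.I • y)⟫_ℂ)) / 4 := by
  simp only [map_add, map_sub, map_smul, inner_add_left, inner_add_right, inner_sub_left,
    inner_sub_right, inner_smul_left, inner_smul_right, Complex.conj_I]
  linear_combination (⟪x, A y⟫_ℂ - ⟪y, A x⟫_ℂ) / 2 * Complex.I_sq

section WeakLimits

variable {ι : Type*} {l : Filter ι} {f : ι → H →L[ℂ] H} {C : ℝ}

lemma tendstoSigmaWeak_of_tendsto_inner (hC : ∀ i, ‖f i‖ ≤ C) {B : H →L[ℂ] H}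
    (h : ∀ x y, Tendsto (fun i => ⟪x, f i y⟫_ℂ) l (𝓝 ⟪x, B y⟫_ℂ)) : TendstoSigmaWeak f l B := by
  refine tendstoSigmaWeak_iff.mpr fun p => ?_
  refine tendsto_tsum_of_dominated_convergence
    (bound := fun n => C * (‖p.1.1 n‖ ^ 2 + ‖p.2.1 n‖ ^ 2)) ((p.1.2.add p.2.2).mul_left C)
    (fun n => h _ _) (Eventually.of_forall fun i n => ?_)
  have hC0 : 0 ≤ C := (norm_nonneg _).trans (hC i)
  grw [norm_inner_apply_le, hC i, ← two_mul_le_add_sq, mul_assoc 2, ← one_le_two (α := ℝ), one_mul]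

lemma exists_tendsto_inner_of_norm_eq_one
    (h : ∀ x : H, ‖x‖ = 1 → ∃ z, Tendsto (fun i => ⟪x, f i x⟫_ℂ) l (𝓝 z)) (x y : H) :
    ∃ z, Tendsto (fun i => ⟪x, f i y⟫_ℂ) l (𝓝 z) := by
  have hquad : ∀ x : H, ∃ z, Tendsto (fun i => ⟪x, f i x⟫_ℂ) l (𝓝 z) := fun x => by
    rcases eq_or_ne x 0 with rfl | hx
    · exact ⟨0, by simp [tendsto_const_nhds]⟩
    obtain ⟨z, hz⟩ := h _ (norm_smul_inv_norm (𝕜 := ℂ) hx)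
    refine ⟨_, (hz.const_mul ((‖x‖ : ℂ) ^ 2)).congr fun i => ?_⟩
    have hx' : (‖x‖ : ℂ) ≠ 0 := by simpa using hx
    rw [map_smul, inner_smul_left, inner_smul_right, map_inv₀, RCLike.conj_ofReal]
    simp only [Complex.coe_algebraMap]
    field_simp
  obtain ⟨z₁, h₁⟩ := hquad (x + y)
  obtain ⟨z₂, h₂⟩ := hquad (x - y)
  obtain ⟨z₃, h₃⟩ := hquad (x + Complex.I • y)
  obtain ⟨z₄, h₄⟩ := hquad (x - Complex.I • y)
  exact ⟨_, (((h₁.sub h₂).sub ((h₃.sub h₄).const_mul Complex.I)).div_const 4).congr fun i =>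
    (inner_apply_polarization (f i) x y).symm⟩

variable [CompleteSpace H] [l.NeBot]

lemma exists_tendsto_inner (hC : ∀ i, ‖f i‖ ≤ C)
    (h : ∀ x y, ∃ z, Tendsto (fun i => ⟪x, f i y⟫_ℂ) l (𝓝 z)) :
    ∃ B : H →L[ℂ] H, ∀ x y, Tendsto (fun i => ⟪x, f i y⟫_ℂ) l (𝓝 ⟪x, B y⟫_ℂ) := by
  choose b hb using h
  let b' : H →ₗ⋆[ℂ] H →ₗ[ℂ] ℂ := LinearMap.mk₂'ₛₗ (starRingEnd ℂ) (RingHom.id ℂ) b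
    (fun x x' y => tendsto_nhds_unique (hb (x + x') y) <| by
      simpa only [inner_add_left] using (hb x y).add (hb x' y))
    (fun c x y => tendsto_nhds_unique (hb (c • x) y) <| by
      simpa only [inner_smul_left, smul_eq_mul] using (hb x y).const_mul _)
    (fun x y y' => tendsto_nhds_unique (hb x (y + y')) <| by
      simpa only [map_add, inner_add_right] using (hb x y).add (hb x y'))
    (fun c x y => tendsto_nhds_unique (hb x (c • y)) <| by
      simpa only [map_smul, inner_smul_right, smul_eq_mul, RingHom.id_apply]
        using (hb x y).const_mul c)
  let β := b'.mkContinuous₂ C fun x y => le_of_tendsto (hb x y).norm <| .of_forall fun i => by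
    grw [norm_inner_apply_le, hC i, mul_assoc]
  refine ⟨ContinuousLinearMap.adjoint (InnerProductSpace.continuousLinearMapOfBilin β),
    fun x y => ?_⟩
  rw [ContinuousLinearMap.adjoint_inner_right]
  convert hb x y using 2
  exact InnerProductSpace.continuousLinearMapOfBilin_apply β x y

end WeakLimits

variable [CompleteSpace H]

/-- `A` has a Lipschitz orbit under the semigroup. -/
def HasLipschitzOrbit (S : QuantumMarkovSemigroup H) (A : H →L[ℂ] H) : Prop :=
  ∃ M : ℝ, ∀ t : ℝ≥0, ‖S.map t A - A‖ ≤ M * t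

variable {S : QuantumMarkovSemigroup H} {A : H →L[ℂ] H}

lemma hasLipschitzOrbit_iff : HasLipschitzOrbit S A ↔ ∃ M, ∀ t, ‖diffQuot S A t‖ ≤ M := by
  have hnorm : ∀ t : ℝ≥0, ‖diffQuot S A t‖ = ‖S.map t A - A‖ / t := fun t => by
    rw [diffQuot, norm_smul, norm_inv, Complex.norm_real, NNReal.norm_eq, inv_mul_eq_div]
  refine ⟨fun ⟨M, hM⟩ => ⟨M, fun t => ?_⟩, fun ⟨M, hM⟩ => ⟨M, fun t => ?_⟩⟩
  · rw [hnorm]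
    exact div_le_of_le_mul₀ t.coe_nonneg (by simpa using (norm_nonneg _).trans (hM 1)) (hM t)
  · rcases eq_or_ne t 0 with rfl | ht
    · simp [S.map_zero]
    · exact (div_le_iff₀ (by positivity)).mp ((hnorm t).symm.trans_le (hM t))

lemma norm_diffQuot_le (S : QuantumMarkovSemigroup H) (A : H →L[ℂ] H) (t : ℝ≥0) :
    ‖diffQuot S A t‖ ≤ 2 * ‖A‖ / t := by
  rw [diffQuot, norm_smul, norm_inv, Complex.norm_real, NNReal.norm_eq, inv_mul_eq_div]
  grw [norm_sub_le, norm_map_le (S.map_one t), two_mul]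

lemma hasLipschitzOrbit_of_mem_domain (hA : A ∈ (generator S).domain) : HasLipschitzOrbit S A := by
  obtain ⟨B, hB⟩ := hA
  refine hasLipschitzOrbit_iff.mpr (exists_norm_le_of_forall_inner fun x y => ?_)
  obtain ⟨δ, hδ, hnear⟩ := Metric.eventually_nhds_iff.mp <| eventually_nhdsWithin_iff.mp
    ((TendstoSigmaWeak.inner hB x y).norm.eventually_le_const (lt_add_one _))
  refine ⟨max (‖⟪x, B y⟫_ℂ‖ + 1) (2 * ‖A‖ / δ * (‖x‖ * ‖y‖)), fun t => ?_⟩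
  rcases eq_or_ne t 0 with rfl | ht
  · simp [diffQuot, add_nonneg]
  rcases lt_or_ge (t : ℝ) δ with htδ | htδ
  · exact le_max_of_le_left (hnear (by simpa [NNReal.dist_eq] using htδ) ht)
  · refine le_max_of_le_right ?_
    grw [norm_inner_apply_le, norm_diffQuot_le, htδ]

lemma continuous_inner_map (S : QuantumMarkovSemigroup H) (A : H →L[ℂ] H) (x y : H) :
    Continuous fun t => ⟪x, S.map t A y⟫_ℂ :=
  continuous_iff_continuousAt.mpr fun t =>
    TendstoSigmaWeak.inner (@Continuous.tendsto _ _ _ (sigmaWeak H) _ (S.continuous_time A) t) x y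

/- Strong continuity at time `0` of the predual semigroup, at vector states: the convergence of
`⟪x, T_t X x⟫` to `⟪x, X x⟫` is uniform in `‖X‖ ≤ 1`. -/
lemma eventually_norm_inner_map_sub_le (S : QuantumMarkovSemigroup H) {x : H} (hx : ‖x‖ = 1) {ε : ℝ}
    (hε : 0 < ε) : ∀ᶠ t in 𝓝 0, ∀ X : H →L[ℂ] H,
      ‖⟪x, S.map t X x⟫_ℂ - ⟪x, X x⟫_ℂ‖ ≤ ε * ‖X‖ := by
  set η : ℝ≥0 → ℝ := fun t => ‖1 - ⟪x, S.map t (rankOne ℂ x x) x⟫_ℂ‖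
  have hη : Continuous η :=
    (continuous_const.sub (continuous_inner_map S (rankOne ℂ x x) x x)).norm
  have hη0 : η 0 = 0 := by simp [η, S.map_zero, inner_self_eq_norm_sq_to_K, hx]
  have hlim : Tendsto (fun t => 2 * √(η t) + η t) (𝓝 0) (𝓝 0) :=
    Continuous.tendsto' (by fun_prop) _ _ (by simp [hη0])
  filter_upwards [hlim.eventually_le_const hε] with t ht X
  grw [norm_inner_map_sub_le (S.map_one t) hx le_rfl X, ht]

lemma inner_map_diffQuot (S : QuantumMarkovSemigroup H) (A : H →L[ℂ] H) (r t : ℝ≥0) (x y : H) :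
    ⟪x, S.map r (diffQuot S A t) y⟫_ℂ
      = (t : ℝ)⁻¹ • (⟪x, S.map (r + t) A y⟫_ℂ - ⟪x, S.map r A y⟫_ℂ) := by
  rw [diffQuot, map_smul, map_sub, ← S.map_add, smul_apply, sub_apply, inner_smul_right,
    inner_sub_right, Complex.real_smul, Complex.ofReal_inv]

/- The time averages `s⁻¹ ∫₀ˢ ⟪x, T_r (diffQuot S A t) x⟫ dr` converge as `t → 0` for every `s`, and
they are uniformly close to `⟪x, diffQuot S A t x⟫` when `s` is small. -/
lemma exists_tendsto_inner_diffQuot (hA : HasLipschitzOrbit S A) {x : H} (hx : ‖x‖ = 1) :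
    ∃ z, Tendsto (fun t => ⟪x, diffQuot S A t x⟫_ℂ) (𝓝[≠] 0) (𝓝 z) := by
  obtain ⟨M, hM⟩ := hasLipschitzOrbit_iff.mp hA
  have hM0 : 0 ≤ M := (norm_nonneg _).trans (hM 0)
  refine exists_tendsto_of_forall_eventually_dist_le fun ε hε => ?_
  have hδ : 0 < ε / (M + 1) := by positivity
  obtain ⟨s, hs, hsX⟩ := Metric.nhds_basis_closedBall.eventually_iff.mp
    (eventually_norm_inner_map_sub_le S hx hδ)
  set f : ℝ → ℂ := fun r => ⟪x, S.map r.toNNReal A x⟫_ℂ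
  have hf : Continuous f := (continuous_inner_map S A x x).comp continuous_real_toNNReal
  have hcoe : Tendsto (fun t : ℝ≥0 => (t : ℝ)) (𝓝[≠] 0) (𝓝[≠] 0) :=
    (NNReal.continuous_coe.continuousAt (x := 0)).continuousWithinAt.tendsto_nhdsWithin
      fun t ht => NNReal.coe_ne_zero.mpr ht
  refine ⟨fun t => s⁻¹ • ∫ r in (0 : ℝ)..s, (t : ℝ)⁻¹ • (f (r + t) - f r), _,
    ((tendsto_integral_slope hf s).comp hcoe).const_smul s⁻¹, Eventually.of_forall fun t => ?_⟩
  rw [dist_comm, dist_eq_norm]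
  refine norm_smul_integral_sub_le hs (by fun_prop) fun r hr => ?_
  have hfr : (t : ℝ)⁻¹ • (f (r + t) - f r) = ⟪x, S.map r.toNNReal (diffQuot S A t) x⟫_ℂ := by
    rw [inner_map_diffQuot, ← Real.toNNReal_coe (r := t), ← Real.toNNReal_add hr.1 t.coe_nonneg,
      Real.toNNReal_coe]
  rw [hfr]
  have hrs : r.toNNReal ∈ Metric.closedBall 0 s := by
    simpa [NNReal.dist_eq, max_eq_left hr.1, abs_of_nonneg hr.1] using hr.2
  grw [hsX hrs, hM t, div_mul_eq_mul_div]
  exact div_le_of_le_mul₀ (by positivity) hε.le <| by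
    gcongr
    exact le_add_of_nonneg_right zero_le_one

theorem mem_domain_iff_hasLipschitzOrbit : A ∈ (generator S).domain ↔ HasLipschitzOrbit S A := by
  refine ⟨hasLipschitzOrbit_of_mem_domain, fun hA => ?_⟩
  obtain ⟨M, hM⟩ := hasLipschitzOrbit_iff.mp hA
  obtain ⟨B, hB⟩ := exists_tendsto_inner hM <|
    exists_tendsto_inner_of_norm_eq_one fun _ hx => exists_tendsto_inner_diffQuot hA hx
  exact ⟨B, tendstoSigmaWeak_of_tendsto_inner hM hB⟩

end Generator

section DomainAlgebra

variable {H : Type u} [NormedAddCommGroup H] [InnerProductSpace ℂ H] [CompleteSpace H]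

/-- The defect of the maps `T_t` at `A` is of order `t`: its square root `defectNorm` is of order
`√t`. -/
def HasLinearDefect (S : QuantumMarkovSemigroup H) (A : H →L[ℂ] H) : Prop :=
  ∃ M : ℝ, ∀ t : ℝ≥0, defectNorm (S.map t) A ≤ M * √t

section Closure

variable {S : QuantumMarkovSemigroup H} {A B : H →L[ℂ] H}

lemma HasLipschitzOrbit.star (hA : HasLipschitzOrbit S A) : HasLipschitzOrbit S (star A) := by
  obtain ⟨M, hM⟩ := hA
  refine ⟨M, fun t => ?_⟩
  rw [map_star_eq, ← star_sub, norm_star]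
  exact hM t

lemma hasLipschitzOrbit_algebraMap (S : QuantumMarkovSemigroup H) (c : ℂ) :
    HasLipschitzOrbit S (algebraMap ℂ _ c) :=
  ⟨0, fun t => by simp [Algebra.algebraMap_eq_smul_one, S.map_one t]⟩

lemma HasLipschitzOrbit.mul (hA : HasLipschitzOrbit S A) (hB : HasLipschitzOrbit S B)
    (hA' : HasLinearDefect S (Star.star A)) (hB' : HasLinearDefect S B) :
    HasLipschitzOrbit S (A * B) := by
  obtain ⟨M, hM⟩ := hA
  obtain ⟨N, hN⟩ := hB
  obtain ⟨M', hM'⟩ := hA'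
  obtain ⟨N', hN'⟩ := hB'
  refine ⟨M' * N' + M * ‖B‖ + ‖A‖ * N, fun t => ?_⟩
  have hdefect : S.map t (A * B) - A * B = defect (S.map t) (Star.star A) B
      + (S.map t A - A) * S.map t B + A * (S.map t B - B) := by
    rw [defect, map_star_eq, star_star, star_star]
    noncomm_ring
  calc ‖S.map t (A * B) - A * B‖
      ≤ defectNorm (S.map t) (Star.star A) * defectNorm (S.map t) B
        + ‖S.map t A - A‖ * ‖S.map t B‖ + ‖A‖ * ‖S.map t B - B‖ := by
        grw [hdefect, norm_add₃_le, norm_defect_le (S.map_one t), norm_mul_le, norm_mul_le]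
    _ ≤ M' * √t * (N' * √t) + M * t * ‖B‖ + ‖A‖ * (N * t) := by
        gcongr
        exacts [Real.sqrt_nonneg _, (Real.sqrt_nonneg _).trans (hM' t), hM' t, hN' t,
          (norm_nonneg _).trans (hM t), hM t, norm_map_le (S.map_one t) B, hN t]
    _ = (M' * N' + M * ‖B‖ + ‖A‖ * N) * t := by
        linear_combination M' * N' * Real.mul_self_sqrt t.coe_nonneg

lemma HasLipschitzOrbit.hasLinearDefect (hA : HasLipschitzOrbit S A)
    (hA' : HasLipschitzOrbit S (Star.star A * A)) : HasLinearDefect S A := by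
  obtain ⟨M, hM⟩ := hA
  obtain ⟨N, hN⟩ := hA'
  refine ⟨√(N + 2 * ‖A‖ * M), fun t => ?_⟩
  rw [← Real.sqrt_mul' _ t.coe_nonneg]
  refine Real.sqrt_le_sqrt ?_
  have hdefect : defect (S.map t) A A = (S.map t (Star.star A * A) - Star.star A * A)
      - Star.star (S.map t A - A) * S.map t A - Star.star A * (S.map t A - A) := by
    rw [defect, star_sub]
    noncomm_ring
  calc ‖defect (S.map t) A A‖
      ≤ ‖S.map t (Star.star A * A) - Star.star A * A‖ + ‖S.map t A - A‖ * ‖S.map t A‖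
        + ‖A‖ * ‖S.map t A - A‖ := by
        grw [hdefect, norm_sub_le, norm_sub_le, norm_mul_le, norm_mul_le, norm_star, norm_star]
    _ ≤ N * t + M * t * ‖A‖ + ‖A‖ * (M * t) := by
        gcongr
        exacts [hN t, (norm_nonneg _).trans (hM t), hM t, norm_map_le (S.map_one t) A, hM t]
    _ = (N + 2 * ‖A‖ * M) * t := by ring

lemma HasLinearDefect.add (hA : HasLinearDefect S A) (hB : HasLinearDefect S B) :
    HasLinearDefect S (A + B) := by
  obtain ⟨M, hM⟩ := hA
  obtain ⟨N, hN⟩ := hB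
  refine ⟨M + N, fun t => ?_⟩
  grw [defectNorm_add_le (S.map_one t), hM t, hN t, add_mul]

lemma HasLinearDefect.mul (hA : HasLinearDefect S A) (hB : HasLinearDefect S B) :
    HasLinearDefect S (A * B) := by
  obtain ⟨M, hM⟩ := hA
  obtain ⟨N, hN⟩ := hB
  refine ⟨M * ‖B‖ + ‖A‖ * N, fun t => ?_⟩
  grw [defectNorm_mul_le (S.map_one t), hM t, hN t]
  exact (by ring : _ = _).le

lemma hasLinearDefect_algebraMap (S : QuantumMarkovSemigroup H) (c : ℂ) :
    HasLinearDefect S (algebraMap ℂ _ c) :=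
  ⟨0, fun t => by simp [defectNorm_algebraMap (S.map_one t) c]⟩

end Closure

/-- The operators with Lipschitz orbit whose defect, and that of their adjoint, is of order `t`. -/
def linearDefectAlgebra (S : QuantumMarkovSemigroup H) : StarSubalgebra ℂ (H →L[ℂ] H) where
  carrier := {A | HasLipschitzOrbit S A ∧ HasLinearDefect S A ∧ HasLinearDefect S (star A)}
  mul_mem' := by
    rintro A B ⟨hA, hA', hA''⟩ ⟨hB, hB', hB''⟩
    exact ⟨hA.mul hB hA'' hB', hA'.mul hB', by rw [star_mul]; exact hB''.mul hA''⟩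
  add_mem' := by
    rintro A B ⟨hA, hA', hA''⟩ ⟨hB, hB', hB''⟩
    refine ⟨?_, hA'.add hB', by rw [star_add]; exact hA''.add hB''⟩
    rw [← mem_domain_iff_hasLipschitzOrbit] at hA hB ⊢
    exact add_mem hA hB
  algebraMap_mem' c := by
    refine ⟨hasLipschitzOrbit_algebraMap S c, hasLinearDefect_algebraMap S c, ?_⟩
    rw [← algebraMap_star_comm]
    exact hasLinearDefect_algebraMap S _
  star_mem' := by
    rintro A ⟨hA, hA', hA''⟩
    exact ⟨hA.star, hA'', by rwa [star_star]⟩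

lemma domainAlgebra_le (S : QuantumMarkovSemigroup H) :
    domainAlgebra S ≤ linearDefectAlgebra S := by
  refine sSup_le fun B hB A hA => ?_
  have hlip : ∀ X ∈ B, HasLipschitzOrbit S X := fun X hX =>
    mem_domain_iff_hasLipschitzOrbit.mp (hB hX)
  have hdefect : ∀ X ∈ B, HasLinearDefect S X := fun X hX =>
    (hlip X hX).hasLinearDefect (hlip _ (mul_mem (star_mem hX) hX))
  exact ⟨hlip A hA, hdefect A hA, hdefect _ (star_mem hA)⟩

theorem mem_domain_of_mem_domainAlgebra (S : QuantumMarkovSemigroup H) (A : H →L[ℂ] H)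
    (hA : A ∈ domainAlgebra S) : A ∈ (generator S).domain :=
  mem_domain_iff_hasLipschitzOrbit.mpr (domainAlgebra_le S hA).1

end DomainAlgebra

section JumpKernel

open InnerProductSpace (rankOne)

variable {H : Type u} [NormedAddCommGroup H] [InnerProductSpace ℂ H]

/-- The drift part `v ↦ D(|v⟩⟨e|) e - ½ Re⟪e, D(|e⟩⟨e|) e⟫ v` of a linear map `D` of operators,
relative to the vector `e`. For a unit vector `e` and a generator `D` this is a choice of the
operator `G` of the Lindblad form. -/
def drift (D : (H →L[ℂ] H) →ₗ[ℂ] (H →L[ℂ] H)) (e : H) : H →ₗ[ℂ] H where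
  toFun v := D (rankOne ℂ v e) e - (((⟪e, D (rankOne ℂ e e) e⟫_ℂ).re / 2 : ℝ) : ℂ) • v
  map_add' v w := by
    simp only [map_add, add_apply, smul_add]
    abel
  map_smul' c v := by
    simp only [map_smul, smul_apply, smul_sub, RingHom.id_apply]
    rw [smul_comm c]

lemma drift_apply (D : (H →L[ℂ] H) →ₗ[ℂ] (H →L[ℂ] H)) (e v : H) :
    drift D e v = D (rankOne ℂ v e) e - (((⟪e, D (rankOne ℂ e e) e⟫_ℂ).re / 2 : ℝ) : ℂ) • v :=
  rfl

lemma drift_smul_sub_id (D : (H →L[ℂ] H) →ₗ[ℂ] (H →L[ℂ] H)) {e : H} (he : ‖e‖ = 1) (r : ℝ) (v : H) :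
    drift ((r : ℂ) • (D - LinearMap.id)) e v = (r : ℂ) • (drift D e v - (1 / 2 : ℂ) • v) := by
  have hee : ⟪e, e⟫_ℂ = 1 := by simp [inner_self_eq_norm_sq_to_K, he]
  simp only [drift_apply, LinearMap.smul_apply, LinearMap.sub_apply, LinearMap.id_apply, smul_apply,
    sub_apply, InnerProductSpace.rankOne_apply, hee, one_smul, inner_smul_right, inner_sub_right,
    Complex.re_ofReal_mul, Complex.sub_re, Complex.one_re]
  push_cast
  module

lemma tendsto_inner_drift {ι : Type*} {l : Filter ι}
    {F : ι → (H →L[ℂ] H) →ₗ[ℂ] (H →L[ℂ] H)} {D : (H →L[ℂ] H) →ₗ[ℂ] (H →L[ℂ] H)} {e v : H}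
    (he : TendstoSigmaWeak (fun i => F i (rankOne ℂ e e)) l (D (rankOne ℂ e e)))
    (hv : TendstoSigmaWeak (fun i => F i (rankOne ℂ v e)) l (D (rankOne ℂ v e))) (u : H) :
    Tendsto (fun i => ⟪u, drift (F i) e v⟫_ℂ) l (𝓝 ⟪u, drift D e v⟫_ℂ) := by
  simp only [drift_apply, inner_sub_right, inner_smul_right]
  have hre := (Complex.continuous_re.tendsto _).comp (he.inner e e)
  exact (hv.inner u e).sub <|
    ((Complex.continuous_ofReal.tendsto _).comp (hre.div_const 2)).mul_const _

variable [CompleteSpace H]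

/-- The matrix elements of `A ↦ D A - G A - (G A*)*`, where `G = drift D e`. -/
def jumpKernel (D : (H →L[ℂ] H) →ₗ[ℂ] (H →L[ℂ] H)) (e : H) (A : H →L[ℂ] H) (u w : H) : ℂ :=
  ⟪u, D A w⟫_ℂ - ⟪u, drift D e (A w)⟫_ℂ - ⟪drift D e (star A u), w⟫_ℂ

lemma tendsto_jumpKernel {ι : Type*} {l : Filter ι}
    {F : ι → (H →L[ℂ] H) →ₗ[ℂ] (H →L[ℂ] H)} {D : (H →L[ℂ] H) →ₗ[ℂ] (H →L[ℂ] H)} {e u w : H}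
    {A : H →L[ℂ] H} (hA : TendstoSigmaWeak (fun i => F i A) l (D A))
    (he : TendstoSigmaWeak (fun i => F i (rankOne ℂ e e)) l (D (rankOne ℂ e e)))
    (hw : TendstoSigmaWeak (fun i => F i (rankOne ℂ (A w) e)) l (D (rankOne ℂ (A w) e)))
    (hu : TendstoSigmaWeak (fun i => F i (rankOne ℂ (star A u) e)) l
      (D (rankOne ℂ (star A u) e))) :
    Tendsto (fun i => jumpKernel (F i) e A u w) l (𝓝 (jumpKernel D e A u w)) := by
  have hconj := (Complex.continuous_conj.tendsto _).comp (tendsto_inner_drift he hu w)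
  simp only [Function.comp_def, inner_conj_symm] at hconj
  exact ((hA.inner u w).sub (tendsto_inner_drift he hw u)).sub hconj

-- Subtracting the identity changes `G` by a multiple of the identity, which cancels the change of
-- `D A`.
lemma jumpKernel_smul_sub_id (D : (H →L[ℂ] H) →ₗ[ℂ] (H →L[ℂ] H)) {e : H} (he : ‖e‖ = 1) (r : ℝ)
    (A : H →L[ℂ] H) (u w : H) :
    jumpKernel ((r : ℂ) • (D - LinearMap.id)) e A u w = (r : ℂ) * jumpKernel D e A u w := by
  have hA : ⟪star A u, w⟫_ℂ = ⟪u, A w⟫_ℂ := A.adjoint_inner_left w u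
  simp only [jumpKernel, drift_smul_sub_id D he, LinearMap.smul_apply, LinearMap.sub_apply,
    LinearMap.id_apply, smul_apply, sub_apply, inner_smul_left, inner_smul_right, inner_sub_left,
    inner_sub_right, Complex.conj_ofReal, map_div₀, map_one, map_ofNat, hA]
  ring

lemma star_rankOne (x y : H) : star (rankOne ℂ x y) = rankOne ℂ y x :=
  InnerProductSpace.adjoint_rankOne x y

section CompletelyPositive

variable (φ : (H →L[ℂ] H) →CP (H →L[ℂ] H)) (e : H)

lemma jumpKernel_completelyPositiveMap (A : H →L[ℂ] H) (u w : H) :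
    jumpKernel φ.toLinearMap e A u w
      = ⟪u, φ A w⟫_ℂ - ⟪u, φ (rankOne ℂ (A w) e) e⟫_ℂ - ⟪φ (rankOne ℂ (star A u) e) e, w⟫_ℂ
        + ⟪u, A w⟫_ℂ * ⟪e, φ (rankOne ℂ e e) e⟫_ℂ := by
  have hA : ⟪star A u, w⟫_ℂ = ⟪u, A w⟫_ℂ := A.adjoint_inner_left w u
  have hreal : ((⟪e, φ (rankOne ℂ e e) e⟫_ℂ).re : ℂ) = ⟪e, φ (rankOne ℂ e e) e⟫_ℂ := by
    rw [← Complex.conj_eq_iff_re, inner_conj_symm, ← inner_map_star, star_rankOne]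
  have hφ : ∀ X, φ.toLinearMap X = φ X := fun _ => rfl
  simp only [jumpKernel, drift_apply, hφ, inner_sub_left, inner_sub_right, inner_smul_left,
    inner_smul_right, Complex.conj_ofReal, hA]
  rw [Complex.ofReal_div, hreal]
  push_cast
  ring

variable {φ} in
/-- The map `u ↦ V u - π(|u⟩⟨e|) V e` built from a Stinespring dilation `φ = V† π V`, which dilates
the jump kernel of `φ`. -/
def jumpMap (d : KernelDilation fun A (u w : H) => ⟪u, φ A w⟫_ℂ) : H →ₗ[ℂ] d.space where
  toFun u := d.map u - d.rep (rankOne ℂ u e) (d.map e)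
  map_add' u w := by
    simp only [map_add, add_apply]
    abel
  map_smul' c u := by simp only [map_smul, smul_apply, smul_sub, RingHom.id_apply]

variable {φ} in
lemma jumpMap_apply (d : KernelDilation fun A (u w : H) => ⟪u, φ A w⟫_ℂ) (u : H) :
    jumpMap e d u = d.map u - d.rep (rankOne ℂ u e) (d.map e) := rfl

theorem nonempty_kernelDilation_jumpKernel :
    Nonempty (KernelDilation (jumpKernel φ.toLinearMap e)) := by
  obtain ⟨d⟩ := nonempty_stinespring φ
  suffices hdilates : ∀ A u w,
      jumpKernel φ.toLinearMap e A u w = ⟪jumpMap e d u, d.rep A (jumpMap e d w)⟫_ℂ from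
    ⟨{ space := d.space
       rep := d.rep
       norm_rep_le := d.norm_rep_le
       map := jumpMap e d
       apply_eq := hdilates }⟩
  intro A u w
  have hAw : A * rankOne ℂ w e = rankOne ℂ (A w) e := InnerProductSpace.comp_rankOne w e A
  have huA : rankOne ℂ e u * A = star (rankOne ℂ (star A u) e) := by
    rw [star_rankOne]; exact InnerProductSpace.rankOne_comp e u A
  have hmap_rank : ⟪d.map u, d.rep A (d.rep (rankOne ℂ w e) (d.map e))⟫_ℂ
      = ⟪u, φ (rankOne ℂ (A w) e) e⟫_ℂ := by
    rw [← hAw, d.apply_eq, map_mul, mul_apply_eq_comp]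
  have hrank_map : ⟪d.rep (rankOne ℂ u e) (d.map e), d.rep A (d.map w)⟫_ℂ
      = ⟪φ (rankOne ℂ (star A u) e) e, w⟫_ℂ := by
    rw [d.inner_rep_mul, star_rankOne, huA, inner_map_star]
  have hrank_rank : ⟪d.rep (rankOne ℂ u e) (d.map e), d.rep A (d.rep (rankOne ℂ w e) (d.map e))⟫_ℂ
      = ⟪u, A w⟫_ℂ * ⟪e, φ (rankOne ℂ e e) e⟫_ℂ := by
    rw [← mul_apply_eq_comp (d.rep A), ← map_mul, d.inner_rep_mul, star_rankOne,
      rankOne_mul_mul_rankOne, map_smul, smul_apply, inner_smul_right]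
  rw [jumpKernel_completelyPositiveMap]
  simp only [jumpMap_apply, map_sub, inner_sub_left, inner_sub_right, hmap_rank, hrank_map,
    hrank_rank, ← d.apply_eq]
  ring

end CompletelyPositive

end JumpKernel

section LindbladForm

open InnerProductSpace (rankOne)

variable {H : Type u} [NormedAddCommGroup H] [InnerProductSpace ℂ H]

lemma inner_sum_smul_rankOne {ι : Type*} [Fintype ι] {v : ι → H} (hv : Orthonormal ℂ v) (c : ι → ℂ)
    (i : ι) (x : H) : ⟪v i, (∑ j, c j • rankOne ℂ (v j) (v j)) x⟫_ℂ = c i * ⟪v i, x⟫_ℂ := by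
  classical
  simp [orthonormal_iff_ite.mp hv]

lemma IsAssociateVector.apply_ne_zero {T : H →L[ℂ] H} {h : H} (hh : IsAssociateVector T h) :
    T h ≠ 0 := by
  obtain ⟨m, t', k', k, hm, ht', hk', rfl, hk, rfl⟩ := hh
  let s₀ : Fin m := ⟨0, hm⟩
  have ht : 0 < ∑ r, t' r := Finset.sum_pos (fun r _ => ht' r) ⟨s₀, Finset.mem_univ _⟩
  have hk_norm : ∀ s, (‖k s‖ : ℂ) = √(∑ r, t' r) := fun s => by
    rw [hk, norm_smul, hk'.1 s, mul_one, Complex.norm_real,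
      Real.norm_of_nonneg (Real.sqrt_nonneg _)]
  have hcoeff : ∀ s, ((‖k s‖ ^ 2)⁻¹ : ℂ) • k s = ((√(∑ r, t' r) : ℂ)⁻¹) • k' s := fun s => by
    have hne : (√(∑ r, t' r) : ℂ) ≠ 0 := by exact_mod_cast (Real.sqrt_pos.mpr ht).ne'
    rw [hk_norm, hk, smul_smul]
    congr 1
    field_simp
  intro h0
  have hinner := inner_sum_smul_rankOne hk' (fun s => (t' s : ℂ)) s₀
    (∑ s, ((‖k s‖ ^ 2)⁻¹ : ℂ) • k s)
  rw [h0, inner_zero_right] at hinner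
  simp only [hcoeff, hk'.inner_right_fintype] at hinner
  simp [(ht' s₀).ne', (Real.sqrt_pos.mpr ht).ne'] at hinner

variable [CompleteSpace H]

lemma exists_linearMap_generator (S : QuantumMarkovSemigroup H) :
    ∃ D : (H →L[ℂ] H) →ₗ[ℂ] (H →L[ℂ] H), ∀ A (hA : A ∈ (generator S).domain),
      D A = generator S ⟨A, hA⟩ := by
  obtain ⟨D, hD⟩ := (generator S).toFun.exists_extend
  exact ⟨D, fun A hA => LinearMap.congr_fun hD ⟨A, hA⟩⟩

/-- The difference quotient `(T_t - id) / t` as a linear map. -/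
def diffQuotₗ (S : QuantumMarkovSemigroup H) (t : ℝ≥0) : (H →L[ℂ] H) →ₗ[ℂ] (H →L[ℂ] H) :=
  (((t : ℝ)⁻¹ : ℝ) : ℂ) • ((S.map t).toLinearMap - LinearMap.id)

lemma diffQuotₗ_apply (S : QuantumMarkovSemigroup H) (t : ℝ≥0) (A : H →L[ℂ] H) :
    diffQuotₗ S t A = diffQuot S A t := by
  rw [diffQuot, ← Complex.ofReal_inv]
  rfl

lemma nonempty_kernelDilation_jumpKernel_diffQuotₗ (S : QuantumMarkovSemigroup H) (t : ℝ≥0) {e : H}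
    (he : ‖e‖ = 1) : Nonempty (KernelDilation (jumpKernel (diffQuotₗ S t) e)) := by
  obtain ⟨d⟩ := nonempty_kernelDilation_jumpKernel (S.map t) e
  have hsmul : jumpKernel (diffQuotₗ S t) e = fun A u w =>
      (((t : ℝ)⁻¹ : ℝ) : ℂ) * jumpKernel (S.map t).toLinearMap e A u w := by
    funext A u w
    exact jumpKernel_smul_sub_id _ he _ A u w
  rw [hsmul]
  exact ⟨d.smul (inv_nonneg.mpr t.coe_nonneg)⟩

theorem nonempty_kernelDilation_jumpKernel_generator {S : QuantumMarkovSemigroup H}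
    {D : (H →L[ℂ] H) →ₗ[ℂ] (H →L[ℂ] H)}
    (hD : ∀ A ∈ (generator S).domain, IsGeneratorAt S A (D A)) {𝒜 : StarSubalgebra ℂ (H →L[ℂ] H)}
    (h𝒜 : ∀ A ∈ 𝒜, A ∈ (generator S).domain) {e : H} (he : ‖e‖ = 1)
    (hee : rankOne ℂ e e ∈ (generator S).domain) {U : Submodule ℂ H}
    (hU : ∀ A ∈ 𝒜, ∀ u ∈ U, rankOne ℂ (A u) e ∈ 𝒜) :
    Nonempty (KernelDilation fun (A : 𝒜) (u w : U) => jumpKernel D e A u w) := by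
  have hlim : ∀ A ∈ (generator S).domain,
      TendstoSigmaWeak (fun t => diffQuotₗ S t A) (𝓝[≠] 0) (D A) := fun A hA => by
    simp only [diffQuotₗ_apply]
    exact hD A hA
  refine nonempty_kernelDilation_of_tendsto (l := 𝓝[≠] (0 : ℝ≥0)) (.of_forall fun t => ?_)
    fun A u w => tendsto_jumpKernel (hlim A (h𝒜 A A.2)) (hlim _ hee)
      (hlim _ (h𝒜 _ (hU A A.2 w w.2))) (hlim _ (h𝒜 _ (hU _ (star_mem A.2) u u.2)))
  obtain ⟨d⟩ := nonempty_kernelDilation_jumpKernel_diffQuotₗ S t he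
  exact ⟨d.restrict 𝒜 U⟩

end LindbladForm

end QMS

end

theorem corollary3p7_general {H : Type u} [NormedAddCommGroup H] [InnerProductSpace ℂ H]
    [CompleteSpace H] (S : QMS.QuantumMarkovSemigroup H) {𝒜 : StarSubalgebra ℂ (H →L[ℂ] H)}
    (hdom : ∀ A ∈ 𝒜, A ∈ (QMS.generator S).domain) {y : H} (hy : y ≠ 0)
    (hydom : InnerProductSpace.rankOne ℂ y y ∈ (QMS.generator S).domain) :
    ∃ (K : Type u) (_ : NormedAddCommGroup K) (_ : InnerProductSpace ℂ K) (_ : CompleteSpace K)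
      (π : 𝒜 →⋆ₐ[ℂ] (K →L[ℂ] K)) (G : QMS.rankOneSubspace 𝒜 y →ₗ[ℂ] H)
      (V : QMS.rankOneSubspace 𝒜 y →ₗ[ℂ] K),
      Continuous π ∧
      ∀ (u w : QMS.rankOneSubspace 𝒜 y) (A : 𝒜),
        ⟪(u : H), QMS.generator S ⟨A, hdom A A.2⟩ (w : H)⟫_ℂ
          = ⟪V u, π A (V w)⟫_ℂ + ⟪(u : H), G (QMS.act A w)⟫_ℂ
            + ⟪G (QMS.act (star A) u), (w : H)⟫_ℂ := by
  obtain ⟨D, hD⟩ := QMS.exists_linearMap_generator S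
  let e : H := (‖y‖ : ℂ)⁻¹ • y
  have hrank : ∀ x : H, InnerProductSpace.rankOne ℂ x e
      = (‖y‖ : ℂ)⁻¹ • InnerProductSpace.rankOne ℂ x y := by simp [e]
  have hee : InnerProductSpace.rankOne ℂ e e ∈ (QMS.generator S).domain := by
    rw [hrank, map_smul]
    exact Submodule.smul_mem _ _ (Submodule.smul_mem _ _ hydom)
  have hU : ∀ A ∈ 𝒜, ∀ u ∈ QMS.rankOneSubspace 𝒜 y, InnerProductSpace.rankOne ℂ (A u) e ∈ 𝒜 :=
    fun A hA u hu => by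
      rw [hrank]
      exact SMulMemClass.smul_mem _ (QMS.act ⟨A, hA⟩ ⟨u, hu⟩).2
  obtain ⟨d⟩ := QMS.nonempty_kernelDilation_jumpKernel_generator
    (fun A hA => hD A hA ▸ QMS.generator_spec S ⟨A, hA⟩) hdom (norm_smul_inv_norm hy) hee hU
  refine ⟨d.space, inferInstance, inferInstance, inferInstance, d.rep,
    QMS.drift D e ∘ₗ (QMS.rankOneSubspace 𝒜 y).subtype, d.map, d.continuous_rep, fun u w A => ?_⟩
  have hdilates : ⟪(u : H), D A w⟫_ℂ - ⟪(u : H), QMS.drift D e (QMS.act A w)⟫_ℂ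
      - ⟪QMS.drift D e (QMS.act (star A) u), (w : H)⟫_ℂ = ⟪d.map u, d.rep A (d.map w)⟫_ℂ :=
    d.apply_eq A u w
  rw [← hdilates, hD A (hdom A A.2)]
  simp only [LinearMap.comp_apply, Submodule.subtype_apply]
  ring

theorem corollary3p7 {H : Type u} [NormedAddCommGroup H] [InnerProductSpace ℂ H] [CompleteSpace H]
    (S : QMS.QuantumMarkovSemigroup H)
    (T : H →L[ℂ] H) (hTpos : T.IsPositive) (hTfin : FiniteDimensional ℂ T.range)
    (hTdom : T ∈ (QMS.generator S).domain)
    (h : H) (hh : QMS.IsAssociateVector T h)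
    (hThdom : InnerProductSpace.rankOne ℂ (T h) (T h) ∈ (QMS.generator S).domain) :
    ∃ hdom : ∀ A ∈ QMS.domainAlgebra S, A ∈ (QMS.generator S).domain,
    ∃ (K : Type u) (_ : NormedAddCommGroup K) (_ : InnerProductSpace ℂ K) (_ : CompleteSpace K)
      (π : QMS.domainAlgebra S →⋆ₐ[ℂ] (K →L[ℂ] K))
      (G : QMS.rankOneSubspace (QMS.domainAlgebra S) (T h) →ₗ[ℂ] H)
      (V : QMS.rankOneSubspace (QMS.domainAlgebra S) (T h) →ₗ[ℂ] K),
      Continuous π ∧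
      ∀ (u w : QMS.rankOneSubspace (QMS.domainAlgebra S) (T h)) (A : QMS.domainAlgebra S),
        ⟪(u : H), QMS.generator S ⟨A, hdom A A.2⟩ (w : H)⟫_ℂ
          = ⟪V u, π A (V w)⟫_ℂ + ⟪(u : H), G (QMS.act A w)⟫_ℂ
            + ⟪G (QMS.act (star A) u), (w : H)⟫_ℂ :=
  ⟨QMS.mem_domain_of_mem_domainAlgebra S,
    corollary3p7_general S _ hh.apply_ne_zero hThdom⟩
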